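/- Let $n\ge 1$, let $q\in(0,2]$, let $f:\mathbb R\to\mathbb R$ be positive, continuous and strictly increasing, and let $g:\mathbb R\to\mathbb R$ be continuous and nondecreasing (no sign assumption). Write $g^+=\max\{g,0\}$, $g^-=\max\{-g,0\}$. For a real symmetric $n\times n$ matrix $X$ let $\mathcal M^+_{0,1}(X)=\sum_{\mu_i(X)>0}\mu_i(X)$ be the sum of its positive eigenvalues, counted with multiplicity. An entire viscosity subsolution of $$\mathcal M^+_{0,1}(D^2u)=f(u)+g(u)\,|Du|^q \qquad (*)$$ is an upper semicontinuous function $u:\mathbb R^n\to\mathbb R$ such that, whenever $x\in\mathbb R^n$, $\varphi$ is of class $C^2$ in a neighbourhood of $x$, and $u-\varphi$ has a local maximum at $x$, one has $\mathcal M^+_{0,1}(D^2\varphi(x))\ge f(u(x))+g(u(x))\,|D\varphi(x)|^q$. The limit $\lim_{t\to+\infty}g(t)$, which exists in $(-\infty,+\infty]$ by monotonicity, is allowed to be $+\infty$. (i) If $\lim_{t\to+\infty}g(t)>0$, then there exists an entire viscosity subsolution of $(*)$ if and only if $$q\le 1\quad\text{and}\quad\int_0^{+\infty}\frac{dt}{(t\,f(t))^{1/2}+(t\,g^+(t))^{1/(2-q)}}=+\infty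 .$$ (ii) If $\lim_{t\to+\infty}g(t)=0$, then there exists an entire viscosity subsolution of $(*)$ if and only if $$\int_0^{+\infty}\frac{dt}{\left(\int_0^t e^{-2\int_s^t\left(\frac{g^-(\tau)}{f(\tau)}\right)^{2/q}f(\tau)\,d\tau}\,f(s)\,ds\right)^{1/2}}=+\infty .$$ (iii) If $\lim_{t\to+\infty}g(t)<0$, then there exists an entire viscosity subsolution of $(*)$ if and only if $$\int_0^{+\infty}\left[\frac1{(t\,f(t))^{1/2}}+\frac1{f(t)^{1/q}}\right]dt=+\infty .$$ -/

import Mathlib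

open Set Filter Topology MeasureTheory

noncomputable section

/-- The degenerate maximal Pucci operator `M⁺_{0,1}`: the sum of the positive eigenvalues
(counted with multiplicity) of a real symmetric matrix. -/
def pucciPlus {n : ℕ} (A : Matrix (Fin n) (Fin n) ℝ) (hA : A.IsHermitian) : ℝ :=
  ∑ i with 0 < hA.eigenvalues i, hA.eigenvalues i

/-- The Hessian matrix `D²φ(x)`. -/
def hessianMatrix {n : ℕ} (φ : EuclideanSpace ℝ (Fin n) → ℝ) (x : EuclideanSpace ℝ (Fin n)) :
    Matrix (Fin n) (Fin n) ℝ :=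
  Matrix.of fun i j =>
    fderiv ℝ (fderiv ℝ φ) x (EuclideanSpace.single i 1) (EuclideanSpace.single j 1)

/-- The Hessian matrix of a function that is `C²` near `x` is symmetric. -/
theorem hessianMatrix_isHermitian {n : ℕ} {φ : EuclideanSpace ℝ (Fin n) → ℝ}
    {x : EuclideanSpace ℝ (Fin n)} (hφ : ContDiffAt ℝ 2 φ x) :
    (hessianMatrix φ x).IsHermitian := by
  have hs : IsSymmSndFDerivAt ℝ φ x := hφ.isSymmSndFDerivAt (by simp)
  ext i j
  simpa [hessianMatrix] using hs.eq (EuclideanSpace.single j 1) (EuclideanSpace.single i 1)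

/-- `u` is an entire viscosity subsolution of `M⁺_{0,1}(D²u) = f(u) + g(u) |Du|^q`: it is upper
semicontinuous on `ℝⁿ` and, whenever `u - φ` has a local maximum at `x` for some `φ` of class `C²`
near `x`, one has `M⁺_{0,1}(D²φ(x)) ≥ f(u(x)) + g(u(x)) |Dφ(x)|^q`. -/
def IsEntireViscositySubsolution {n : ℕ} (f g : ℝ → ℝ) (q : ℝ)
    (u : EuclideanSpace ℝ (Fin n) → ℝ) : Prop :=
  UpperSemicontinuous u ∧
    ∀ (x : EuclideanSpace ℝ (Fin n)) (φ : EuclideanSpace ℝ (Fin n) → ℝ)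
      (hφ : ContDiffAt ℝ 2 φ x), IsLocalMax (fun y => u y - φ y) x →
        f (u x) + g (u x) * ‖gradient φ x‖ ^ q
          ≤ pucciPlus (hessianMatrix φ x) (hessianMatrix_isHermitian hφ)

/-- `q ≤ 1` and `∫₀^∞ dt / ((t f(t))^{1/2} + (t g⁺(t))^{1/(2-q)}) = +∞`. -/
def KellerOssermanPos (f g : ℝ → ℝ) (q : ℝ) : Prop :=
  q ≤ 1 ∧
    ∫⁻ t in Ioi (0 : ℝ), ENNReal.ofReal
      (1 / ((t * f t) ^ (1 / 2 : ℝ) + (t * max (g t) 0) ^ (1 / (2 - q)))) = ⊤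

/-- `∫₀^∞ dt / (∫₀^t exp(-2 ∫_s^t (g⁻(τ)/f(τ))^{2/q} f(τ) dτ) f(s) ds)^{1/2} = +∞`. -/
def KellerOssermanZero (f g : ℝ → ℝ) (q : ℝ) : Prop :=
  ∫⁻ t in Ioi (0 : ℝ), ENNReal.ofReal
    (1 / (∫ s in (0 : ℝ)..t,
      Real.exp (-2 * ∫ τ in s..t, (max (-g τ) 0 / f τ) ^ (2 / q) * f τ) * f s) ^ (1 / 2 : ℝ)) = ⊤

/-- `∫₀^∞ [1 / (t f(t))^{1/2} + 1 / f(t)^{1/q}] dt = +∞`. -/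
def KellerOssermanNeg (f : ℝ → ℝ) (q : ℝ) : Prop :=
  ∫⁻ t in Ioi (0 : ℝ), ENNReal.ofReal
    (1 / (t * f t) ^ (1 / 2 : ℝ) + 1 / (f t) ^ (1 / q)) = ⊤

end

/-!
Both halves of each equivalence reduce to an inequality for one function `E` of one variable.
A profile `φ` with `φ'² = E(φ)` has `φ'' = E'(φ) / 2`, and the time it needs to climb from `a` to
`t` is `∫_a^t E^{-1/2}`; it is global or blows up in finite time according to whether this integral
diverges. Inverting the travel time (`IsEnergy.exists_profile`) gives an even `C²` profile, also
when `f` and `g` are merely continuous and no differential equation is solved.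

* If `E' ≥ 2 (f + g E^{q/2})` and the integral diverges, `u(x) = φ(x₀)` is an entire subsolution,
  because `M⁺_{0,1}` dominates every diagonal entry (`IsEnergy.exists_subsolution`).
* If `0 ≤ E' ≤ 2 (f / n + (g⁺ / n - g⁻) E^{q/2})` and the integral converges, the sum
  `a + ∑ᵢ (φ(xᵢ) - a)` is a barrier on a cube at whose boundary it is as large as desired. Its
  Hessian is diagonal and nonnegative, so `M⁺_{0,1}` is the trace, and strict monotonicity of `f`
  forces every subsolution to lie below it; so `u(0) ≤ a`
  (`IsEnergy.apply_zero_le_of_subsolution`). If this is possible for arbitrarily small `a`, there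
  is no subsolution.

It remains to choose `E`.

* For `g ≤ 0` let `k = (g⁻ / f)^{2/q} f` and let `W` solve `W' = f - 2 k W`, `W(a) = 0`. Since
  `k / f` is nonincreasing, `2 k W ≤ f`. In terms of `y = (g⁻ / f)^{1/q} E^{1/2}` the gradient term
  is `f y^q` and the linear damping is `f y²`, and comparing `y²` with `y^q` on the bounded range of
  `y` shows that `E = 2 W` is a subsolution and `E = c W` a barrier for small `c`
  (`exists_subsolution_iff_kellerOssermanZero`). If moreover `g ≤ -m < 0`, then `W(t)` is comparable
  with `min (t f) (f^{2/q})`, up to halving `t` (`kellerOssermanZero_iff_kellerOssermanNeg`).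
* For `g` eventually positive put `p = 2 / (2 - q)`. When `q ≤ 1`, the energy
  `25 (∫_t^{2t} f + (∫_t^{2t} g⁺)^p)` is a subsolution
  (`exists_subsolution_of_kellerOssermanPos`). A barrier is `c W` plus a small multiple of
  `(∫ g⁺)^p`, the integral starting far out; as the exponent `q` may be lowered to some
  `r ∈ (1, 2)` when `q > 1`, in that case the barrier blows up for every `f`
  (`not_exists_subsolution_of_lintegral_ne_top`).
-/

/-! ### Test functions, Hessians and the maximal operator -/

/-- Every diagonal entry, being an average of the eigenvalues, is at most the sum of the positive
eigenvalues. -/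
theorem diag_le_pucciPlus {n : ℕ} (A : Matrix (Fin n) (Fin n) ℝ) (hA : A.IsHermitian)
    (i : Fin n) : A i i ≤ pucciPlus A hA := by
  have hU := (Matrix.mem_unitaryGroup_iff (A := (hA.eigenvectorUnitary : Matrix (Fin n) (Fin n) ℝ))).1
    hA.eigenvectorUnitary.2
  set U : Matrix (Fin n) (Fin n) ℝ := (hA.eigenvectorUnitary : Matrix (Fin n) (Fin n) ℝ) with hUdef
  have hA' : A i i = ∑ j, hA.eigenvalues j * (U i j) ^ 2 := by
    have h := hA.spectral_theorem
    rw [Unitary.conjStarAlgAut_apply] at h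
    have h2 := congrFun (congrFun h i) i
    rw [h2, Matrix.mul_apply]
    refine Finset.sum_congr rfl fun j _ => ?_
    rw [Matrix.mul_diagonal]
    simp only [Matrix.star_apply, ← hUdef, Function.comp_apply, RCLike.ofReal_real_eq_id, id,
      star_trivial]
    ring
  have hone : ∑ j, (U i j) ^ 2 = 1 := by
    have h2 := congrFun (congrFun hU i) i
    rw [Matrix.mul_apply] at h2
    simpa [Matrix.star_apply, sq] using h2
  rw [hA', pucciPlus, Finset.sum_filter]
  refine Finset.sum_le_sum fun j _ => ?_
  have hj : (U i j) ^ 2 ≤ 1 := hone ▸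
    Finset.single_le_sum (f := fun j => (U i j) ^ 2) (fun _ _ => sq_nonneg _) (Finset.mem_univ j)
  split_ifs with h
  · nlinarith
  · nlinarith [sq_nonneg (U i j)]

theorem pucciPlus_eq_trace {n : ℕ} (A : Matrix (Fin n) (Fin n) ℝ) (hA : A.IsHermitian)
    (hpos : A.PosSemidef) : pucciPlus A hA = A.trace := by
  rw [hA.trace_eq_sum_eigenvalues, pucciPlus, Finset.sum_filter]
  refine Finset.sum_congr rfl fun j _ => ?_
  have := hpos.eigenvalues_nonneg j
  split_ifs with h
  · rfl
  · simpa using le_antisymm this (not_lt.1 h)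

theorem IsLocalMax.second_deriv_nonpos {h h₁ : ℝ → ℝ} {h₂ x : ℝ} (hmax : IsLocalMax h x)
    (hd : ∀ᶠ y in 𝓝 x, HasDerivAt h (h₁ y) y) (hd' : HasDerivAt h₁ h₂ x) : h₂ ≤ 0 := by
  by_contra! hpos
  have e1 : deriv h =ᶠ[𝓝 x] h₁ := hd.mono fun y hy => hy.deriv
  have e2 : deriv (deriv h) x = h₂ := by rw [e1.deriv_eq, hd'.deriv]
  have hmin : IsLocalMin h x := isLocalMin_of_deriv_deriv_pos (by rw [e2]; exact hpos)
    hmax.deriv_eq_zero hd.self_of_nhds.continuousAt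
  -- a point that is both a local maximum and a local minimum has vanishing second derivative
  have hc : h =ᶠ[𝓝 x] fun _ => h x := by
    filter_upwards [hmax, hmin] with y h1 h2 using le_antisymm h1 h2
  have e3 : deriv (deriv h) x = 0 := by
    rw [hc.deriv.deriv_eq]; simp
  linarith

theorem gradient_eq_toLp_of_fderiv {n : ℕ} {ψ : EuclideanSpace ℝ (Fin n) → ℝ}
    {x : EuclideanSpace ℝ (Fin n)} {d : Fin n → ℝ}
    (h : ∀ v : EuclideanSpace ℝ (Fin n), fderiv ℝ ψ x v = ∑ i, d i * v i) :
    gradient ψ x = WithLp.toLp 2 d := by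
  rw [gradient, LinearIsometryEquiv.symm_apply_eq]
  ext v
  rw [h v, InnerProductSpace.toDual_apply_apply, PiLp.inner_apply]
  simp [mul_comm]

theorem contDiffAt_two_of_hasDerivAt {φ φ₁ φ₂ : ℝ → ℝ} {S : Set ℝ} (hS : IsOpen S)
    (h1 : ∀ x ∈ S, HasDerivAt φ (φ₁ x) x) (h2 : ∀ x ∈ S, HasDerivAt φ₁ (φ₂ x) x)
    (h3 : ContinuousOn φ₂ S) {x : ℝ} (hx : x ∈ S) : ContDiffAt ℝ 2 φ x := by
  have key : ∀ (m : ℕ) (χ χ' : ℝ → ℝ), (∀ x ∈ S, HasDerivAt χ (χ' x) x) →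
      ContDiffOn ℝ m χ' S → ContDiffOn ℝ (m + 1) χ S := by
    intro m χ χ' h h'
    rw [contDiffOn_succ_iff_deriv_of_isOpen hS]
    exact ⟨fun y hy => (h y hy).differentiableAt.differentiableWithinAt, by simp,
      ContDiffOn.congr h' fun y hy => (h y hy).deriv⟩
  have a0 : ContDiffOn ℝ (0 : ℕ) φ₂ S := by exact_mod_cast (contDiffOn_zero (𝕜 := ℝ)).2 h3
  have a1 := key 0 φ₁ φ₂ h2 a0
  have a2 := key 1 φ φ₁ h1 (by simpa using a1)
  have a3 : ContDiffOn ℝ 2 φ S := by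
    have : ((1 : ℕ) + 1 : WithTop ℕ∞) = 2 := by norm_num
    rwa [this] at a2
  exact a3.contDiffAt (hS.mem_nhds hx)

section SeparableSum

variable {n : ℕ} {φ φ₁ φ₂ : ℝ → ℝ} {S : Set ℝ}

theorem hasFDerivAt_separableSum (c : ℝ) (h1 : ∀ x ∈ S, HasDerivAt φ (φ₁ x) x)
    {x : EuclideanSpace ℝ (Fin n)} (hx : ∀ i, x i ∈ S) :
    HasFDerivAt (fun y : EuclideanSpace ℝ (Fin n) => c + ∑ i, φ (y i))
      (∑ i, φ₁ (x i) • (EuclideanSpace.proj i : StrongDual ℝ (EuclideanSpace ℝ (Fin n)))) x := by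
  refine HasFDerivAt.const_add c (HasFDerivAt.fun_sum fun i _ => ?_)
  exact (h1 (x i) (hx i)).comp_hasFDerivAt x
    (EuclideanSpace.proj i : StrongDual ℝ (EuclideanSpace ℝ (Fin n))).hasFDerivAt

theorem hessianMatrix_separableSum (c : ℝ) (hS : IsOpen S)
    (h1 : ∀ x ∈ S, HasDerivAt φ (φ₁ x) x) (h2 : ∀ x ∈ S, HasDerivAt φ₁ (φ₂ x) x)
    {x : EuclideanSpace ℝ (Fin n)} (hx : ∀ i, x i ∈ S) :
    hessianMatrix (fun y : EuclideanSpace ℝ (Fin n) => c + ∑ i, φ (y i)) x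
      = Matrix.diagonal fun i => φ₂ (x i) := by
  have hnear : ∀ᶠ y in 𝓝 x, ∀ i, y i ∈ S := by
    rw [eventually_all]
    intro i
    exact (EuclideanSpace.proj i : StrongDual ℝ (EuclideanSpace ℝ (Fin n))).continuous.continuousAt
      (hS.mem_nhds (hx i))
  have e : fderiv ℝ (fun y : EuclideanSpace ℝ (Fin n) => c + ∑ i, φ (y i)) =ᶠ[𝓝 x]
      fun y => ∑ i, φ₁ (y i) •
        (EuclideanSpace.proj i : StrongDual ℝ (EuclideanSpace ℝ (Fin n))) :=
    hnear.mono fun y hy => (hasFDerivAt_separableSum c h1 hy).fderiv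
  have hd : HasFDerivAt (fun y : EuclideanSpace ℝ (Fin n) => ∑ i, φ₁ (y i) •
        (EuclideanSpace.proj i : StrongDual ℝ (EuclideanSpace ℝ (Fin n))))
      (∑ i, (φ₂ (x i) • (EuclideanSpace.proj i : StrongDual ℝ (EuclideanSpace ℝ (Fin n)))).smulRight
        (EuclideanSpace.proj i : StrongDual ℝ (EuclideanSpace ℝ (Fin n)))) x := by
    refine HasFDerivAt.fun_sum fun i _ => ?_
    have hi := (h2 (x i) (hx i)).comp_hasFDerivAt x
      (EuclideanSpace.proj i : StrongDual ℝ (EuclideanSpace ℝ (Fin n))).hasFDerivAt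
    exact hi.smul_const (F := StrongDual ℝ (EuclideanSpace ℝ (Fin n))) (EuclideanSpace.proj i)
  ext i j
  rw [hessianMatrix, Matrix.of_apply, e.fderiv_eq, hd.fderiv]
  simp [Matrix.diagonal_apply, Finset.sum_ite_eq, eq_comm]

theorem contDiffAt_separableSum (c : ℝ) (hS : IsOpen S)
    (h1 : ∀ x ∈ S, HasDerivAt φ (φ₁ x) x) (h2 : ∀ x ∈ S, HasDerivAt φ₁ (φ₂ x) x)
    (h3 : ContinuousOn φ₂ S)
    {x : EuclideanSpace ℝ (Fin n)} (hx : ∀ i, x i ∈ S) :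
    ContDiffAt ℝ 2 (fun y : EuclideanSpace ℝ (Fin n) => c + ∑ i, φ (y i)) x := by
  refine contDiffAt_const.add (ContDiffAt.sum fun i _ => ?_)
  exact ContDiffAt.comp x (contDiffAt_two_of_hasDerivAt hS h1 h2 h3 (hx i))
    (EuclideanSpace.proj i : StrongDual ℝ (EuclideanSpace ℝ (Fin n))).contDiff.contDiffAt

theorem gradient_separableSum (c : ℝ) (h1 : ∀ x ∈ S, HasDerivAt φ (φ₁ x) x)
    {x : EuclideanSpace ℝ (Fin n)} (hx : ∀ i, x i ∈ S) :
    gradient (fun y : EuclideanSpace ℝ (Fin n) => c + ∑ i, φ (y i)) x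
      = WithLp.toLp 2 fun i => φ₁ (x i) := by
  refine gradient_eq_toLp_of_fderiv fun v => ?_
  rw [(hasFDerivAt_separableSum c h1 hx).fderiv]
  simp

end SeparableSum

/-! ### One-dimensional profiles by quadrature -/

theorem hasDerivAt_of_eventually_punctured {f g : ℝ → ℝ} {x : ℝ}
    (hfg : ∀ᶠ y in 𝓝[≠] x, HasDerivAt f (g y) y) (hf : ContinuousAt f x)
    (hg : ContinuousAt g x) : HasDerivAt f (g x) x := by
  rw [eventually_nhdsWithin_iff, Metric.eventually_nhds_iff] at hfg
  obtain ⟨δ, hδ, h⟩ := hfg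
  have hr : ∀ y ∈ Ioo x (x + δ), HasDerivAt f (g y) y := fun y hy =>
    h (by rw [Real.dist_eq, abs_lt]; constructor <;> linarith [hy.1, hy.2]) (ne_of_gt hy.1)
  have hl : ∀ y ∈ Ioo (x - δ) x, HasDerivAt f (g y) y := fun y hy =>
    h (by rw [Real.dist_eq, abs_lt]; constructor <;> linarith [hy.1, hy.2]) (ne_of_lt hy.2)
  have hR : HasDerivWithinAt f (g x) (Ici x) x := by
    refine hasDerivWithinAt_Ici_of_tendsto_deriv (s := Ioo x (x + δ))
      (fun y hy => (hr y hy).differentiableAt.differentiableWithinAt) hf.continuousWithinAt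
      (Ioo_mem_nhdsGT (by linarith)) ?_
    refine (tendsto_nhdsWithin_of_tendsto_nhds hg).congr' ?_
    filter_upwards [Ioo_mem_nhdsGT (show x < x + δ by linarith)] with y hy using (hr y hy).deriv.symm
  have hL : HasDerivWithinAt f (g x) (Iic x) x := by
    refine hasDerivWithinAt_Iic_of_tendsto_deriv (s := Ioo (x - δ) x)
      (fun y hy => (hl y hy).differentiableAt.differentiableWithinAt) hf.continuousWithinAt
      (Ioo_mem_nhdsLT (by linarith)) ?_
    refine (tendsto_nhdsWithin_of_tendsto_nhds hg).congr' ?_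
    filter_upwards [Ioo_mem_nhdsLT (show x - δ < x by linarith)] with y hy using (hl y hy).deriv.symm
  simpa [Iic_union_Ici] using hL.union hR

/-- `E` is the squared speed of a profile starting at rest from height `a`: as a function of the
height it is of class `C¹` with derivative `E'`, vanishes at `a` to first order exactly, and is
nondecreasing above `a`. -/
structure IsEnergy (E E' : ℝ → ℝ) (a : ℝ) : Prop where
  hasDerivAt : ∀ t, HasDerivAt E (E' t) t
  continuous_deriv : Continuous E'
  apply_base : E a = 0
  deriv_base_pos : 0 < E' a
  deriv_nonneg : ∀ t, a ≤ t → 0 ≤ E' t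

/-- The time that a profile with squared speed `E` takes to climb from height `a` to height `t`. -/
noncomputable def travelTime (E : ℝ → ℝ) (a t : ℝ) : ℝ := ∫ s in a..t, (√(E s))⁻¹

/-- The symmetric interval of times reached by the profile with squared speed `E`. -/
def reachedTimes (E : ℝ → ℝ) (a : ℝ) : Set ℝ := {x | ∃ t, a ≤ t ∧ |x| < travelTime E a t}

theorem isOpen_reachedTimes (E : ℝ → ℝ) (a : ℝ) : IsOpen (reachedTimes E a) := by
  have : reachedTimes E a = ⋃ t ∈ Ici a, {x | |x| < travelTime E a t} := by
    ext x; simp [reachedTimes]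
  rw [this]
  exact isOpen_biUnion fun t _ => isOpen_lt continuous_abs continuous_const

namespace IsEnergy

variable {E E' : ℝ → ℝ} {a : ℝ}

theorem continuous (h : IsEnergy E E' a) : Continuous E :=
  continuous_iff_continuousAt.2 fun t => (h.hasDerivAt t).continuousAt

theorem monotoneOn (h : IsEnergy E E' a) : MonotoneOn E (Ici a) := by
  refine monotoneOn_of_deriv_nonneg (convex_Ici a) h.continuous.continuousOn
    (fun t _ => (h.hasDerivAt t).differentiableAt.differentiableWithinAt) fun t ht => ?_
  rw [interior_Ici] at ht
  rw [(h.hasDerivAt t).deriv]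
  exact h.deriv_nonneg t (le_of_lt ht)

theorem exists_linear_lower_bound (h : IsEnergy E E' a) :
    ∃ δ > 0, ∀ t ∈ Icc a (a + δ), E' a / 2 * (t - a) ≤ E t := by
  have hs := (h.hasDerivAt a).tendsto_slope
  have hev : ∀ᶠ t in 𝓝[≠] a, E' a / 2 < slope E a t :=
    hs.eventually (lt_mem_nhds (by linarith [h.deriv_base_pos]))
  rw [eventually_nhdsWithin_iff, Metric.eventually_nhds_iff] at hev
  obtain ⟨δ, hδ, hb⟩ := hev
  refine ⟨δ / 2, by positivity, fun t ht => ?_⟩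
  rcases eq_or_lt_of_le ht.1 with rfl | hlt
  · simp [h.apply_base]
  · have h1 := hb (y := t) (by rw [Real.dist_eq, abs_lt]; constructor <;> linarith [ht.2])
      (ne_of_gt hlt)
    rw [slope_def_field, h.apply_base, sub_zero, lt_div_iff₀ (by linarith)] at h1
    exact h1.le

theorem pos (h : IsEnergy E E' a) {t : ℝ} (ht : a < t) : 0 < E t := by
  obtain ⟨δ, hδ, hb⟩ := h.exists_linear_lower_bound
  have hm : a < min t (a + δ) := lt_min ht (by linarith)
  have h1 := hb (min t (a + δ)) ⟨hm.le, min_le_right _ _⟩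
  have h2 := h.monotoneOn (mem_Ici.2 hm.le) (mem_Ici.2 ht.le) (min_le_left t (a + δ))
  have h3 := mul_pos (half_pos h.deriv_base_pos) (sub_pos.2 hm)
  linarith

/-- The inverse speed has a singularity of type `(t - a)^{-1/2}` at the base, which is integrable. -/
theorem intervalIntegrable (h : IsEnergy E E' a) {b : ℝ} (hb : a ≤ b) :
    IntervalIntegrable (fun s => (√(E s))⁻¹) volume a b := by
  obtain ⟨δ, hδ, hlow⟩ := h.exists_linear_lower_bound
  have hc : 0 < E' a / 2 := half_pos h.deriv_base_pos
  have hEδ : 0 < E (a + δ) := h.pos (by linarith)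
  have hdom : IntervalIntegrable (fun s => (√(E' a / 2))⁻¹ * (s - a) ^ (-(1 / 2) : ℝ)
      + (√(E (a + δ)))⁻¹) volume a b := by
    have h0 : IntervalIntegrable (fun s : ℝ => s ^ (-(1 / 2) : ℝ)) volume (a - a) (b - a) :=
      intervalIntegral.intervalIntegrable_rpow' (by norm_num)
    have h1 := h0.comp_sub_right a
    simp only [sub_add_cancel] at h1
    exact (h1.const_mul _).add intervalIntegrable_const
  refine hdom.mono_fun ?_ ?_
  · have : Measurable fun s => (√(E s))⁻¹ := (h.continuous.measurable.sqrt).inv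
    exact this.aestronglyMeasurable
  · rw [uIoc_of_le hb]
    refine (ae_restrict_iff' measurableSet_Ioc).2 (Eventually.of_forall fun s hs => ?_)
    have hsa : 0 < s - a := sub_pos.2 hs.1
    have p1 : 0 ≤ (√(E' a / 2))⁻¹ * (s - a) ^ (-(1 / 2) : ℝ) := by positivity
    have p2 : 0 ≤ (√(E (a + δ)))⁻¹ := by positivity
    beta_reduce
    rw [Real.norm_of_nonneg (by positivity), Real.norm_of_nonneg (by positivity)]
    rcases le_total s (a + δ) with hle | hle
    · have h1 := hlow s ⟨hs.1.le, hle⟩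
      have h2 : (√(E s))⁻¹ ≤ (√(E' a / 2 * (s - a)))⁻¹ :=
        inv_anti₀ (Real.sqrt_pos.2 (by positivity)) (Real.sqrt_le_sqrt h1)
      rw [Real.sqrt_mul hc.le, mul_inv, Real.sqrt_eq_rpow (s - a), ← Real.rpow_neg hsa.le] at h2
      linarith
    · have h1 : E (a + δ) ≤ E s :=
        h.monotoneOn (mem_Ici.2 (by linarith)) (mem_Ici.2 hs.1.le) hle
      have h2 : (√(E s))⁻¹ ≤ (√(E (a + δ)))⁻¹ :=
        inv_anti₀ (Real.sqrt_pos.2 hEδ) (Real.sqrt_le_sqrt h1)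
      linarith

theorem hasDerivAt_travelTime (h : IsEnergy E E' a) {t : ℝ} (ht : a < t) :
    HasDerivAt (travelTime E a) ((√(E t))⁻¹) t := by
  refine intervalIntegral.integral_hasDerivAt_right (h.intervalIntegrable ht.le) ?_ ?_
  · have : Measurable fun s => (√(E s))⁻¹ := (h.continuous.measurable.sqrt).inv
    exact this.stronglyMeasurable.stronglyMeasurableAtFilter
  · exact (h.continuous.sqrt.continuousAt).inv₀ (Real.sqrt_pos.2 (h.pos ht)).ne'

theorem continuousOn_travelTime (h : IsEnergy E E' a) (b : ℝ) (hb : a ≤ b) :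
    ContinuousOn (travelTime E a) (Icc a b) := by
  have := intervalIntegral.continuousOn_primitive_interval' (h.intervalIntegrable hb) left_mem_uIcc
  rwa [uIcc_of_le hb] at this

theorem travelTime_base (E : ℝ → ℝ) (a : ℝ) : travelTime E a a = 0 := by simp [travelTime]

theorem strictMonoOn_travelTime (h : IsEnergy E E' a) : StrictMonoOn (travelTime E a) (Ici a) := by
  have hc : ContinuousOn (travelTime E a) (Ici a) := by
    intro t ht
    have := h.continuousOn_travelTime (t + 1) (by linarith [mem_Ici.1 ht]) t
      ⟨ht, by linarith⟩
    refine this.mono_of_mem_nhdsWithin ?_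
    rw [mem_nhdsWithin]
    exact ⟨Iio (t + 1), isOpen_Iio, by simp, fun y hy => ⟨hy.2, le_of_lt hy.1⟩⟩
  refine strictMonoOn_of_deriv_pos (convex_Ici a) hc fun t ht => ?_
  rw [interior_Ici] at ht
  rw [(h.hasDerivAt_travelTime ht).deriv]
  exact inv_pos.2 (Real.sqrt_pos.2 (h.pos ht))

/-- Inverting the travel time produces an even solution `φ` of `φ'' = E'(φ) / 2` with
`φ'² = E(φ)`, of class `C²` also at the origin. -/
theorem exists_profile (h : IsEnergy E E' a) :
    ∃ φ : ℝ → ℝ, (∀ x ∈ reachedTimes E a, a ≤ φ x ∧ travelTime E a (φ x) = |x|) ∧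
      (∀ x ∈ reachedTimes E a, HasDerivAt φ (Real.sign x * √(E (φ x))) x) ∧
      (∀ x ∈ reachedTimes E a,
        HasDerivAt (fun y => Real.sign y * √(E (φ y))) (E' (φ x) / 2) x) ∧
      (∀ x ∈ reachedTimes E a, |Real.sign x * √(E (φ x))| = √(E (φ x))) ∧
      ContinuousOn φ (reachedTimes E a) := by
  set S := reachedTimes E a with hS
  set X := travelTime E a with hX
  have hSo : IsOpen S := isOpen_reachedTimes E a
  have hX0 : X a = 0 := travelTime_base E a
  have hmono : StrictMonoOn X (Ici a) := h.strictMonoOn_travelTime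
  have hex : ∀ x, ∃ s, x ∈ S → a ≤ s ∧ X s = |x| := by
    intro x
    by_cases hx : x ∈ S
    · obtain ⟨t, hat, hxt⟩ := hx
      obtain ⟨s, hs, hsx⟩ := intermediate_value_Icc hat (h.continuousOn_travelTime t hat)
        (show |x| ∈ Icc (X a) (X t) from ⟨by rw [hX0]; exact abs_nonneg x, hxt.le⟩)
      exact ⟨s, fun _ => ⟨hs.1, hsx⟩⟩
    · exact ⟨a, fun h => absurd h hx⟩
  choose φ hφ using hex
  have hφa : ∀ x ∈ S, a ≤ φ x := fun x hx => (hφ x hx).1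
  have hφX : ∀ x ∈ S, X (φ x) = |x| := fun x hx => (hφ x hx).2
  have hcont : ∀ x ∈ S, ContinuousAt φ x := by
    intro x hx
    refine tendsto_order.2 ⟨fun b hb => ?_, fun b hb => ?_⟩
    · rcases lt_or_ge b a with hba | hab
      · filter_upwards [hSo.mem_nhds hx] with y hy using hba.trans_le (hφa y hy)
      · have h1 : X b < |x| := hφX x hx ▸ hmono hab (hφa x hx) hb
        filter_upwards [hSo.mem_nhds hx, continuous_abs.continuousAt.eventually_const_lt h1]
          with y hy hy2
        rw [← hφX y hy] at hy2
        exact (hmono.lt_iff_lt hab (hφa y hy)).1 hy2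
    · have hab : a ≤ b := (hφa x hx).trans hb.le
      have h1 : |x| < X b := hφX x hx ▸ hmono (hφa x hx) hab hb
      filter_upwards [hSo.mem_nhds hx, continuous_abs.continuousAt.eventually_lt_const h1]
        with y hy hy2
      rw [← hφX y hy] at hy2
      exact (hmono.lt_iff_lt (hφa y hy) hab).1 hy2
  have hgt : ∀ x ∈ S, x ≠ 0 → a < φ x := by
    intro x hx hx0
    refine lt_of_le_of_ne (hφa x hx) fun heq => ?_
    have := hφX x hx
    rw [← heq, hX0] at this
    exact hx0 (abs_eq_zero.1 this.symm)
  -- near a nonzero point the sign is locally constant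
  have hsign : ∀ x : ℝ, x ≠ 0 → (Real.sign x = 1 ∨ Real.sign x = -1) ∧
      ∀ᶠ y in 𝓝 x, Real.sign y = Real.sign x ∧ Real.sign x * |y| = y := by
    intro x hx0
    rcases lt_or_gt_of_ne hx0 with hneg | hpos
    · refine ⟨Or.inr (Real.sign_of_neg hneg), ?_⟩
      filter_upwards [gt_mem_nhds hneg] with y hy
      rw [Real.sign_of_neg hy, Real.sign_of_neg hneg, abs_of_neg hy]
      simp
    · refine ⟨Or.inl (Real.sign_of_pos hpos), ?_⟩
      filter_upwards [lt_mem_nhds hpos] with y hy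
      rw [Real.sign_of_pos hy, Real.sign_of_pos hpos, abs_of_pos hy]
      simp
  have hd1 : ∀ x ∈ S, x ≠ 0 → HasDerivAt φ (Real.sign x * √(E (φ x))) x := by
    intro x hx hx0
    obtain ⟨hσ, hev⟩ := hsign x hx0
    have hpos : 0 < √(E (φ x)) := Real.sqrt_pos.2 (h.pos (hgt x hx hx0))
    have hσ0 : Real.sign x ≠ 0 := by rcases hσ with e | e <;> rw [e] <;> norm_num
    have hf : HasDerivAt (fun t => Real.sign x * X t) (Real.sign x * (√(E (φ x)))⁻¹) (φ x) :=
      (h.hasDerivAt_travelTime (hgt x hx hx0)).const_mul _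
    have hinv := HasDerivAt.of_local_left_inverse (hcont x hx) hf
      (mul_ne_zero hσ0 (inv_ne_zero hpos.ne')) (by
        filter_upwards [hev, hSo.mem_nhds hx] with y hy hyS
        rw [hφX y hyS, hy.2])
    have e : Real.sign x * √(E (φ x)) = (Real.sign x * (√(E (φ x)))⁻¹)⁻¹ := by
      rw [mul_inv, inv_inv]
      rcases hσ with e | e <;> rw [e] <;> norm_num
    rw [e]
    exact hinv
  have hφ0 : (0 : ℝ) ∈ S → φ 0 = a := fun hx =>
    hmono.injOn (hφa 0 hx) (mem_Ici.2 le_rfl) ((hφX 0 hx).trans (abs_zero.trans hX0.symm))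
  have hφ1c : ∀ x ∈ S, x = 0 → ContinuousAt (fun y => Real.sign y * √(E (φ y))) x := by
    rintro x hx rfl
    have hlim : Tendsto (fun y => √(E (φ y))) (𝓝 0) (𝓝 0) := by
      have : ContinuousAt (fun y => √(E (φ y))) 0 :=
        (h.continuous.sqrt.continuousAt (x := φ 0)).comp (f := φ) (hcont 0 hx)
      have h2 := this.tendsto
      simpa [hφ0 hx, h.apply_base] using h2
    rw [ContinuousAt, Real.sign_zero, zero_mul]
    refine squeeze_zero_norm (fun y => ?_) hlim
    rw [norm_mul, Real.norm_of_nonneg (Real.sqrt_nonneg _)]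
    refine mul_le_of_le_one_left (Real.sqrt_nonneg _) ?_
    rcases Real.sign_apply_eq y with e | e | e <;> rw [e] <;> simp
  have hd1' : ∀ x ∈ S, HasDerivAt φ (Real.sign x * √(E (φ x))) x := by
    intro x hx
    by_cases hx0 : x = 0
    · refine hasDerivAt_of_eventually_punctured (g := fun y => Real.sign y * √(E (φ y))) ?_
        (hcont x hx) (hφ1c x hx hx0)
      filter_upwards [self_mem_nhdsWithin, mem_nhdsWithin_of_mem_nhds (hSo.mem_nhds hx)] with y hy hyS
      exact hd1 y hyS (hx0 ▸ hy)
    · exact hd1 x hx hx0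
  have hd2 : ∀ x ∈ S, x ≠ 0 →
      HasDerivAt (fun y => Real.sign y * √(E (φ y))) (E' (φ x) / 2) x := by
    intro x hx hx0
    obtain ⟨hσ, hev⟩ := hsign x hx0
    have hEpos := h.pos (hgt x hx hx0)
    have hpos : 0 < √(E (φ x)) := Real.sqrt_pos.2 hEpos
    have h1 := (((h.hasDerivAt (φ x)).comp x (hd1 x hx hx0)).sqrt hEpos.ne').const_mul (Real.sign x)
    have h2 : HasDerivAt (fun y => Real.sign y * √(E (φ y))) _ x :=
      h1.congr_of_eventuallyEq (by filter_upwards [hev] with y hy; rw [hy.1]; rfl)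
    have e : E' (φ x) / 2 = Real.sign x *
        (E' (φ x) * (Real.sign x * √(E (φ x))) / (2 * √((E ∘ φ) x))) := by
      rw [Function.comp_apply]
      rcases hσ with e | e <;> rw [e] <;> field_simp
    rw [e]
    exact h2
  have habs : ∀ x ∈ S, |Real.sign x * √(E (φ x))| = √(E (φ x)) := by
    intro x hx
    rw [abs_mul, abs_of_nonneg (Real.sqrt_nonneg _)]
    by_cases hx0 : x = 0
    · rw [hx0, hφ0 (hx0 ▸ hx), h.apply_base]; simp
    · rcases (hsign x hx0).1 with e | e <;> rw [e] <;> simp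
  refine ⟨φ, hφ, hd1', fun x hx => ?_, habs, fun x hx => (hcont x hx).continuousWithinAt⟩
  by_cases hx0 : x = 0
  · refine hasDerivAt_of_eventually_punctured (g := fun y => E' (φ y) / 2) ?_
      (hφ1c x hx hx0) ?_
    · filter_upwards [self_mem_nhdsWithin, mem_nhdsWithin_of_mem_nhds (hSo.mem_nhds hx)] with y hy hyS
      exact hd2 y hyS (hx0 ▸ hy)
    · exact (h.continuous_deriv.continuousAt.comp (hcont x hx)).div_const 2
  · exact hd2 x hx hx0

end IsEnergy

/-! ### Subsolutions depending on one coordinate -/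

/-- A convex profile solving the one-dimensional inequality for all times, composed with a
coordinate, is an entire subsolution: a test function is tested along that coordinate only. -/
theorem IsEnergy.exists_subsolution {E E' f g : ℝ → ℝ} {a q : ℝ} {n : ℕ} (hn : 1 ≤ n)
    (h : IsEnergy E E' a) (hS : ∀ x, x ∈ reachedTimes E a)
    (hineq : ∀ t, a ≤ t → 2 * (f t + g t * √(E t) ^ q) ≤ E' t) :
    ∃ u : EuclideanSpace ℝ (Fin n) → ℝ, IsEntireViscositySubsolution f g q u := by
  obtain ⟨φ, hφ, hd1, hd2, habs, hφc⟩ := h.exists_profile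
  let i : Fin n := ⟨0, hn⟩
  set pr : StrongDual ℝ (EuclideanSpace ℝ (Fin n)) := EuclideanSpace.proj i with hpr
  have hcont : Continuous φ := by
    rw [← continuousOn_univ]; exact hφc.mono fun x _ => hS x
  refine ⟨fun x => φ (x i), (hcont.comp pr.continuous).upperSemicontinuous, ?_⟩
  intro x ψ hψ hmax
  set e : EuclideanSpace ℝ (Fin n) := EuclideanSpace.single i 1 with he
  set p : ℝ := Real.sign (x i) * √(E (φ (x i))) with hp
  have hψ1 : ∀ᶠ y in 𝓝 x, DifferentiableAt ℝ ψ y :=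
    (hψ.eventually (by simp)).mono fun y hy => hy.differentiableAt (by norm_num)
  have hψ2 : DifferentiableAt ℝ (fderiv ℝ ψ) x :=
    (hψ.fderiv_right (m := 1) (by norm_num)).differentiableAt (by norm_num)
  -- first order: the gradients agree
  have hgrad : fderiv ℝ ψ x = p • pr := by
    have hu : HasFDerivAt (fun y : EuclideanSpace ℝ (Fin n) => φ (y i)) (p • pr) x :=
      (hd1 (x i) (hS _)).comp_hasFDerivAt x pr.hasFDerivAt
    have h0 := hmax.fderiv_eq_zero
    rw [(hu.fun_sub hψ1.self_of_nhds.hasFDerivAt).fderiv] at h0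
    exact (sub_eq_zero.1 h0).symm
  have hnorm : ‖gradient ψ x‖ = √(E (φ (x i))) := by
    rw [← habs _ (hS _), gradient_eq_toLp_of_fderiv (d := Pi.single i p) fun v => by
      simp [hgrad, hpr, Pi.single_apply]]
    exact (PiLp.norm_single (β := fun _ : Fin n => ℝ) 2 i p).trans (Real.norm_eq_abs p)
  -- second order: restrict to the line through `x` in the chosen direction
  have hγ : ∀ s : ℝ, HasDerivAt (fun s : ℝ => x + s • e) e s := fun s => by
    simpa using ((hasDerivAt_id s).smul_const e).const_add x
  have hγ0 : Tendsto (fun s : ℝ => x + s • e) (𝓝 0) (𝓝 x) := by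
    have := (hγ 0).continuousAt.tendsto
    simpa using this
  have hcoord : ∀ s : ℝ, (x + s • e) i = x i + s := fun s => by simp [he]
  have hmaxl : IsLocalMax (fun s : ℝ => φ (x i + s) - ψ (x + s • e)) 0 := by
    have := hγ0.eventually hmax
    filter_upwards [this] with s hs
    simpa [hcoord] using hs
  have hsecond : E' (φ (x i)) / 2 - fderiv ℝ (fderiv ℝ ψ) x e e ≤ 0 := by
    refine hmaxl.second_deriv_nonpos
      (h₁ := fun s => Real.sign (x i + s) * √(E (φ (x i + s))) - fderiv ℝ ψ (x + s • e) e) ?_ ?_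
    · filter_upwards [hγ0.eventually hψ1] with s hs
      exact ((hd1 _ (hS _)).comp_const_add (x i) s).sub
        (hs.hasFDerivAt.comp_hasDerivAt s (hγ s))
    · have h1 : HasDerivAt (fun s => Real.sign (x i + s) * √(E (φ (x i + s))))
          (E' (φ (x i)) / 2) 0 := by
        have := (hd2 (x i + 0) (hS _)).comp_const_add (x i) 0
        simpa using this
      have hx0 : HasFDerivAt (fderiv ℝ ψ) (fderiv ℝ (fderiv ℝ ψ) x) (x + (0 : ℝ) • e) := by
        simpa using hψ2.hasFDerivAt
      have h2 := hx0.comp_hasDerivAt (0 : ℝ) (hγ 0)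
      have h3 : HasDerivAt (fun s : ℝ => fderiv ℝ ψ (x + s • e) e)
          (fderiv ℝ (fderiv ℝ ψ) x e e) 0 := by
        simpa using h2.clm_apply (hasDerivAt_const (0 : ℝ) e)
      exact h1.sub h3
  have hdiag := diag_le_pucciPlus _ (hessianMatrix_isHermitian hψ) i
  have hent : hessianMatrix ψ x i i = fderiv ℝ (fderiv ℝ ψ) x e e := rfl
  have hfin := hineq (φ (x i)) (hφ _ (hS _)).1
  rw [hnorm]
  linarith

/-! ### Comparison with a separable barrier -/

theorem rpow_norm_le_sum {n : ℕ} {q : ℝ} (hq0 : 0 < q) (hq2 : q ≤ 2) (p : Fin n → ℝ) :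
    ‖(WithLp.toLp 2 p : EuclideanSpace ℝ (Fin n))‖ ^ q ≤ ∑ i, |p i| ^ q := by
  have key : ∀ s : Finset (Fin n), (∑ i ∈ s, |p i| ^ 2) ^ (q / 2) ≤ ∑ i ∈ s, |p i| ^ q := by
    intro s
    induction s using Finset.induction_on with
    | empty => simp [Real.zero_rpow (show q / 2 ≠ 0 by positivity)]
    | insert i s hi ih =>
      rw [Finset.sum_insert hi, Finset.sum_insert hi]
      refine (Real.rpow_add_le_add_rpow (by positivity)
        (Finset.sum_nonneg fun _ _ => by positivity) (by positivity) (by linarith)).trans ?_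
      refine add_le_add (le_of_eq ?_) ih
      rw [← Real.rpow_natCast, ← Real.rpow_mul (abs_nonneg _)]
      congr 1; push_cast; ring
  rw [EuclideanSpace.norm_eq, Real.sqrt_eq_rpow, ← Real.rpow_mul
    (Finset.sum_nonneg fun _ _ => by positivity)]
  refine le_trans (le_of_eq ?_) (key Finset.univ)
  simp only [Real.norm_eq_abs]
  congr 1; ring

theorem isCompact_cube (n : ℕ) (r : ℝ) :
    IsCompact {x : EuclideanSpace ℝ (Fin n) | ∀ i, |x i| ≤ r} := by
  have h := (isCompact_univ_pi fun _ : Fin n => isCompact_Icc (a := -r) (b := r)).image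
    (PiLp.continuous_toLp 2 fun _ : Fin n => ℝ)
  convert h using 1
  ext x
  constructor
  · intro hx
    exact ⟨x.ofLp, fun i _ => abs_le.1 (hx i), rfl⟩
  · rintro ⟨y, hy, rfl⟩ i
    exact abs_le.2 (hy i trivial)

/-- A profile solving the reverse inequality, with the constants needed to superpose `n` of its
copies, and blowing up in finite time yields the barrier `a + ∑ᵢ (φ(xᵢ) - a)` on a cube; a
subsolution stays below it, so its value at the centre is at most `a`. -/
theorem IsEnergy.apply_zero_le_of_subsolution {E E' f g : ℝ → ℝ} {a q B : ℝ} {n : ℕ} (hn : 1 ≤ n)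
    (hq0 : 0 < q) (hq2 : q ≤ 2) (hf : StrictMono f) (hg : Monotone g)
    (h : IsEnergy E E' a) (hB : ∀ t, a ≤ t → travelTime E a t ≤ B)
    (hineq : ∀ t, a ≤ t →
      E' t ≤ 2 * (f t / n + (max (g t) 0 / n - max (-g t) 0) * √(E t) ^ q))
    {u : EuclideanSpace ℝ (Fin n) → ℝ} (hu : IsEntireViscositySubsolution f g q u) :
    u 0 ≤ a := by
  by_contra! hua
  obtain ⟨φ, hφ, hd1, hd2, habs, hφc⟩ := h.exists_profile
  obtain ⟨husc, hvisc⟩ := hu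
  have hB0 : 0 ≤ B := by have := hB a le_rfl; rwa [travelTime_base] at this
  obtain ⟨z, -, hz⟩ := UpperSemicontinuousOn.exists_isMaxOn
    (s := {x : EuclideanSpace ℝ (Fin n) | ∀ i, |x i| ≤ B}) ⟨0, fun i => by simpa using hB0⟩
    (isCompact_cube n B) (husc.upperSemicontinuousOn _)
  set T : ℝ := max (u z - u 0 + a) a + 1 with hT
  have hTa : a < T := by have := le_max_right (u z - u 0 + a) a; linarith
  have hTu : u z - u 0 + a < T := by have := le_max_left (u z - u 0 + a) a; linarith
  set r := travelTime E a T with hr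
  have hsm := h.strictMonoOn_travelTime
  have hr0 : 0 < r := by
    have := hsm (mem_Ici.2 le_rfl) (mem_Ici.2 hTa.le) hTa
    rwa [travelTime_base] at this
  have hrS : ∀ y : ℝ, |y| ≤ r → y ∈ reachedTimes E a := fun y hy =>
    ⟨T + 1, by linarith, hy.trans_lt
      (hsm (mem_Ici.2 hTa.le) (mem_Ici.2 (by linarith)) (by linarith))⟩
  set Φ : EuclideanSpace ℝ (Fin n) → ℝ := fun y => (a - n * a) + ∑ i, φ (y i) with hΦ
  have hΦ' : ∀ y, Φ y = a + ∑ i, (φ (y i) - a) := fun y => by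
    simp [hΦ, Finset.sum_sub_distrib]; ring
  set K := {x : EuclideanSpace ℝ (Fin n) | ∀ i, |x i| ≤ r} with hK
  have hKS : ∀ y ∈ K, ∀ i, y i ∈ reachedTimes E a := fun y hy i => hrS _ (hy i)
  have hΦc : ContinuousOn Φ K := by
    intro y hy
    exact (hasFDerivAt_separableSum _ hd1 (hKS y hy)).continuousAt.continuousWithinAt
  have h0K : (0 : EuclideanSpace ℝ (Fin n)) ∈ K := fun i => by simpa using hr0.le
  have hφ0 : φ 0 = a := by
    have h0 := hφ 0 (hrS 0 (by simpa using hr0.le))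
    exact hsm.injOn h0.1 (mem_Ici.2 le_rfl) (h0.2.trans (abs_zero.trans (travelTime_base E a).symm))
  have hle : ∀ y ∈ K, ∀ i, φ (y i) ≤ Φ y := by
    intro y hy i
    rw [hΦ' y]
    have := Finset.single_le_sum (f := fun j => φ (y j) - a)
      (fun j _ => sub_nonneg.2 (hφ _ (hKS y hy j)).1) (Finset.mem_univ i)
    linarith
  obtain ⟨x, hxK, hx⟩ := UpperSemicontinuousOn.exists_isMaxOn ⟨0, h0K⟩ (isCompact_cube n r)
    ((husc.upperSemicontinuousOn K).add hΦc.neg.upperSemicontinuousOn)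
  have hx0 : u 0 - a ≤ u x - Φ x := by
    have h1 := hx h0K
    have h2 : Φ 0 = a := by rw [hΦ' 0]; simp [hφ0]
    simp only [mem_ofPred_eq, h2, Pi.neg_apply] at h1
    linarith
  -- the barrier is too high on the boundary of the cube for the maximum to sit there
  have hint : ∀ i, |x i| < r := by
    intro i
    refine lt_of_le_of_ne (hxK i) fun heq => ?_
    have h1 := hφ _ (hKS x hxK i)
    have h2 : φ (x i) = T := hsm.injOn h1.1 (mem_Ici.2 hTa.le) (h1.2.trans heq)
    have h3 := hle x hxK i
    have h4 : u x ≤ u z := hz (fun j => (hxK j).trans (hB T hTa.le))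
    linarith
  have hKn : K ∈ 𝓝 x := by
    have : ∀ᶠ y : EuclideanSpace ℝ (Fin n) in 𝓝 x, ∀ i, |y i| < r := by
      rw [eventually_all]
      intro i
      exact ((EuclideanSpace.proj i : StrongDual ℝ (EuclideanSpace ℝ (Fin n))).continuous.abs
        ).continuousAt.eventually_lt_const (hint i)
    filter_upwards [this] with y hy i using (hy i).le
  have hmax : IsLocalMax (fun y => u y - Φ y) x := by
    filter_upwards [hKn] with y hy
    have := hx hy
    simpa [sub_eq_add_neg] using this
  have hSo := isOpen_reachedTimes E a
  have hφ2c : ContinuousOn (fun y => E' (φ y) / 2) (reachedTimes E a) :=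
    (h.continuous_deriv.comp_continuousOn hφc).div_const 2
  have hcd : ContDiffAt ℝ 2 Φ x := contDiffAt_separableSum _ hSo hd1 hd2 hφ2c (hKS x hxK)
  have hmain := hvisc x Φ hcd hmax
  have hH : hessianMatrix Φ x = Matrix.diagonal fun i => E' (φ (x i)) / 2 :=
    hessianMatrix_separableSum _ hSo hd1 hd2 (hKS x hxK)
  have hφa : ∀ i, a ≤ φ (x i) := fun i => (hφ _ (hKS x hxK i)).1
  have hpsd : (hessianMatrix Φ x).PosSemidef := by
    rw [hH]
    refine Matrix.PosSemidef.diagonal fun i => ?_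
    exact div_nonneg (h.deriv_nonneg _ (hφa i)) zero_le_two
  rw [pucciPlus_eq_trace _ _ hpsd, hH, Matrix.trace_diagonal,
    gradient_separableSum _ hd1 (hKS x hxK)] at hmain
  set P : Fin n → ℝ := fun i => Real.sign (x i) * √(E (φ (x i))) with hP
  set N := ‖(WithLp.toLp 2 P : EuclideanSpace ℝ (Fin n))‖ with hN
  have hPN : ∀ i, |P i| ≤ N := fun i => by
    have := PiLp.norm_apply_le (WithLp.toLp 2 P : EuclideanSpace ℝ (Fin n)) i
    simpa using this
  have hPE : ∀ i, √(E (φ (x i))) = |P i| := fun i => (habs _ (hKS x hxK i)).symm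
  have hlt : ∀ i, φ (x i) < u x := fun i => by
    have := hle x hxK i; linarith
  have hn0 : (0 : ℝ) < n := by exact_mod_cast hn
  have hne : (Finset.univ : Finset (Fin n)).Nonempty := ⟨⟨0, hn⟩, Finset.mem_univ _⟩
  have hfsum : ∑ i, f (φ (x i)) / n < f (u x) := by
    have : ∑ i : Fin n, f (φ (x i)) / n < ∑ _i : Fin n, f (u x) / n :=
      Finset.sum_lt_sum_of_nonempty hne fun i _ => by
        have := hf (hlt i)
        gcongr
    refine this.trans_eq ?_
    simp; field_simp
  have hgsum : ∑ i, (max (g (φ (x i))) 0 / n - max (-g (φ (x i))) 0) * |P i| ^ q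
      ≤ g (u x) * N ^ q := by
    have hgl : ∀ i, g (φ (x i)) ≤ g (u x) := fun i => hg (hlt i).le
    rcases le_or_gt 0 (g (u x)) with h0 | h0
    · have : ∀ i ∈ (Finset.univ : Finset (Fin n)),
          (max (g (φ (x i))) 0 / n - max (-g (φ (x i))) 0) * |P i| ^ q ≤ g (u x) / n * N ^ q := by
        intro i _
        have a1 : max (g (φ (x i))) 0 / n - max (-g (φ (x i))) 0 ≤ g (u x) / n := by
          have b1 : max (g (φ (x i))) 0 / n ≤ g (u x) / n := by
            gcongr
            exact max_le (hgl i) h0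
          linarith [le_max_right (-g (φ (x i))) 0]
        have a2 : |P i| ^ q ≤ N ^ q := Real.rpow_le_rpow (abs_nonneg _) (hPN i) hq0.le
        have a3 : 0 ≤ |P i| ^ q := by positivity
        have a4 : 0 ≤ g (u x) / n := by positivity
        nlinarith
      refine (Finset.sum_le_sum this).trans_eq ?_
      simp; field_simp
    · have : ∀ i ∈ (Finset.univ : Finset (Fin n)),
          (max (g (φ (x i))) 0 / n - max (-g (φ (x i))) 0) * |P i| ^ q ≤ g (u x) * |P i| ^ q := by
        intro i _
        have a1 : g (φ (x i)) < 0 := (hgl i).trans_lt h0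
        rw [max_eq_right a1.le, max_eq_left (by linarith)]
        have a3 : 0 ≤ |P i| ^ q := by positivity
        have := hgl i
        rw [zero_div]
        nlinarith
      refine (Finset.sum_le_sum this).trans ?_
      rw [← Finset.mul_sum]
      exact mul_le_mul_of_nonpos_left (rpow_norm_le_sum hq0 hq2 P) h0.le
  have hEsum : ∑ i, E' (φ (x i)) / 2 ≤ ∑ i, f (φ (x i)) / n +
      ∑ i, (max (g (φ (x i))) 0 / n - max (-g (φ (x i))) 0) * |P i| ^ q := by
    rw [← Finset.sum_add_distrib]
    refine Finset.sum_le_sum fun i _ => ?_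
    have := hineq _ (hφa i)
    rw [hPE i] at this
    linarith
  linarith

/-! ### Comparison of improper integrals -/

theorem lintegral_Ioi_comp_mul {c : ℝ} (hc : 0 < c) (b : ℝ) (G : ℝ → ENNReal) :
    ∫⁻ t in Ioi b, G (c * t) = ENNReal.ofReal c⁻¹ * ∫⁻ t in Ioi (c * b), G t := by
  have h1 : ∀ t, (Ioi b).indicator (fun t => G (c * t)) t = (Ioi (c * b)).indicator G (c * t) := by
    intro t
    simp only [indicator, mem_Ioi, mul_lt_mul_iff_right₀ hc]
  have h2 := lintegral_map_equiv (μ := volume) ((Ioi (c * b)).indicator G)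
    (Homeomorph.mulLeft₀ c hc.ne').toMeasurableEquiv
  have h3 : Measure.map (Homeomorph.mulLeft₀ c hc.ne').toMeasurableEquiv volume
      = ENNReal.ofReal |c⁻¹| • (volume : Measure ℝ) := Real.map_volume_mul_left hc.ne'
  rw [h3, lintegral_smul_measure, abs_of_pos (inv_pos.2 hc)] at h2
  rw [← lintegral_indicator measurableSet_Ioi, ← lintegral_indicator measurableSet_Ioi,
    ← smul_eq_mul, h2]
  exact lintegral_congr h1

/-- Comparison of improper integrals, up to a multiplicative constant and a dilation of the
variable. -/
theorem lintegral_Ioi_ne_top_of_le {F G : ℝ → ℝ} {b c C : ℝ} (hc : 0 < c) (hC : 0 ≤ C)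
    (hFG : ∀ t, b < t → F t ≤ C * G (c * t))
    (hG : ∫⁻ t in Ioi (c * b), ENNReal.ofReal (G t) ≠ ⊤) :
    ∫⁻ t in Ioi b, ENNReal.ofReal (F t) ≠ ⊤ := by
  have h1 : ∫⁻ t in Ioi b, ENNReal.ofReal (F t)
      ≤ ∫⁻ t in Ioi b, ENNReal.ofReal C * ENNReal.ofReal (G (c * t)) := by
    refine setLIntegral_mono' measurableSet_Ioi fun t ht => ?_
    rw [← ENNReal.ofReal_mul hC]
    exact ENNReal.ofReal_le_ofReal (hFG t ht)
  refine ne_top_of_le_ne_top ?_ h1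
  rw [lintegral_const_mul' _ _ ENNReal.ofReal_ne_top,
    lintegral_Ioi_comp_mul hc b fun t => ENNReal.ofReal (G t)]
  exact ENNReal.mul_ne_top ENNReal.ofReal_ne_top (ENNReal.mul_ne_top ENNReal.ofReal_ne_top hG)

/-! ### Divergence of the travel time -/

namespace IsEnergy

variable {E E' : ℝ → ℝ} {a : ℝ}

theorem mem_reachedTimes_of_lintegral_eq_top (h : IsEnergy E E' a)
    (htop : ∫⁻ t in Ioi a, ENNReal.ofReal ((√(E t))⁻¹) = ⊤) (x : ℝ) :
    x ∈ reachedTimes E a := by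
  by_contra hx
  have hbd : ∀ t, a ≤ t → travelTime E a t ≤ |x| := by
    intro t ht
    by_contra! hlt
    exact hx ⟨t, ht, hlt⟩
  have hint : IntegrableOn (fun t => (√(E t))⁻¹) (Ioi a) := by
    refine integrableOn_Ioi_of_intervalIntegral_norm_bounded (b := fun k : ℕ => a + k) |x| a
      (fun k => ?_) (tendsto_atTop_add_const_left _ _ tendsto_natCast_atTop_atTop)
      (Eventually.of_forall fun k => ?_)
    · exact (intervalIntegrable_iff_integrableOn_Ioc_of_le (by simp)).1
        (h.intervalIntegrable (by simp))
    · have : ∀ t, ‖(√(E t))⁻¹‖ = (√(E t))⁻¹ := fun t => Real.norm_of_nonneg (by positivity)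
      simp only [this]
      exact hbd _ (by simp)
  exact hint.lintegral_lt_top.ne htop

theorem exists_travelTime_le_of_lintegral_ne_top (h : IsEnergy E E' a) {b : ℝ} (hab : a ≤ b)
    (hfin : ∫⁻ t in Ioi b, ENNReal.ofReal ((√(E t))⁻¹) ≠ ⊤) :
    ∃ B, ∀ t, a ≤ t → travelTime E a t ≤ B := by
  refine ⟨travelTime E a b + (∫⁻ t in Ioi b, ENNReal.ofReal ((√(E t))⁻¹)).toReal, fun t ht => ?_⟩
  rcases le_total t b with htb | hbt
  · have := h.strictMonoOn_travelTime.monotoneOn (mem_Ici.2 ht) (mem_Ici.2 hab) htb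
    linarith [ENNReal.toReal_nonneg (a := ∫⁻ t in Ioi b, ENNReal.ofReal ((√(E t))⁻¹))]
  · have hib := h.intervalIntegrable hab
    have hit := h.intervalIntegrable ht
    have hbt' : IntervalIntegrable (fun s => (√(E s))⁻¹) volume b t := hib.symm.trans hit
    have e : travelTime E a t = travelTime E a b + ∫ s in b..t, (√(E s))⁻¹ :=
      (intervalIntegral.integral_add_adjacent_intervals hib hbt').symm
    rw [e]
    refine add_le_add le_rfl ?_
    have hnn : 0 ≤ᵐ[volume.restrict (Ioc b t)] fun s => (√(E s))⁻¹ :=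
      Eventually.of_forall fun s => inv_nonneg.2 (Real.sqrt_nonneg _)
    rw [intervalIntegral.integral_of_le hbt, ← ENNReal.ofReal_le_iff_le_toReal hfin,
      ofReal_integral_eq_lintegral_ofReal
        ((intervalIntegrable_iff_integrableOn_Ioc_of_le hbt).1 hbt') hnn]
    exact lintegral_mono_set Ioc_subset_Ioi_self

end IsEnergy

/-! ### A damped linear equation -/

/-- The solution `W` of the linear equation `W' = f - 2 k W` that vanishes at `a`. -/
noncomputable def dampedPrimitive (k f : ℝ → ℝ) (a t : ℝ) : ℝ :=
  ∫ s in a..t, Real.exp (-2 * ∫ τ in s..t, k τ) * f s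

section DampedPrimitive

variable {k f : ℝ → ℝ}

theorem exp_neg_two_integral (hk : Continuous k) (s t : ℝ) :
    Real.exp (-2 * ∫ τ in s..t, k τ)
      = Real.exp (-2 * ∫ τ in (0 : ℝ)..t, k τ) * Real.exp (2 * ∫ τ in (0 : ℝ)..s, k τ) := by
  rw [← Real.exp_add, ← intervalIntegral.integral_interval_sub_left
    (hk.intervalIntegrable 0 t) (hk.intervalIntegrable 0 s)]
  congr 1; ring

theorem continuous_exp_neg_two_integral (hk : Continuous k) (t : ℝ) :
    Continuous fun s => Real.exp (-2 * ∫ τ in s..t, k τ) := by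
  rw [funext fun s => exp_neg_two_integral hk s t]
  have := intervalIntegral.continuous_primitive (fun a b => hk.intervalIntegrable (μ := volume) a b) 0
  fun_prop

theorem hasDerivAt_primitive {h : ℝ → ℝ} (hh : Continuous h) (a t : ℝ) :
    HasDerivAt (fun t => ∫ s in a..t, h s) (h t) t :=
  intervalIntegral.integral_hasDerivAt_right (hh.intervalIntegrable a t)
    (hh.stronglyMeasurableAtFilter _ _) hh.continuousAt

theorem hasDerivAt_dampedPrimitive (hk : Continuous k) (hf : Continuous f) (a t : ℝ) :
    HasDerivAt (dampedPrimitive k f a) (f t - 2 * k t * dampedPrimitive k f a t) t := by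
  have hform : ∀ t, dampedPrimitive k f a t = Real.exp (-2 * ∫ τ in (0 : ℝ)..t, k τ) *
      ∫ s in a..t, Real.exp (2 * ∫ τ in (0 : ℝ)..s, k τ) * f s := by
    intro t
    rw [dampedPrimitive, ← intervalIntegral.integral_const_mul]
    refine intervalIntegral.integral_congr fun s _ => ?_
    rw [exp_neg_two_integral hk]; ring
  have hc : Continuous fun s => Real.exp (2 * ∫ τ in (0 : ℝ)..s, k τ) * f s := by
    have := intervalIntegral.continuous_primitive
      (fun a b => hk.intervalIntegrable (μ := volume) a b) 0
    fun_prop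
  have h1 := ((hasDerivAt_primitive hk 0 t).const_mul (-2)).exp.mul (hasDerivAt_primitive hc a t)
  have h2 : HasDerivAt (dampedPrimitive k f a) _ t :=
    h1.congr_of_eventuallyEq (Eventually.of_forall hform)
  convert h2 using 1
  rw [hform t, ← mul_assoc (Real.exp _) (Real.exp _), ← Real.exp_add]
  have : -2 * (∫ τ in (0 : ℝ)..t, k τ) + 2 * ∫ τ in (0 : ℝ)..t, k τ = 0 := by ring
  rw [this, Real.exp_zero]
  ring

theorem dampedPrimitive_base (k f : ℝ → ℝ) (a : ℝ) : dampedPrimitive k f a a = 0 := by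
  simp [dampedPrimitive]

theorem intervalIntegrable_dampedPrimitive (hk : Continuous k) (hf : Continuous f) (t a b : ℝ) :
    IntervalIntegrable (fun s => Real.exp (-2 * ∫ τ in s..t, k τ) * f s) volume a b :=
  ((continuous_exp_neg_two_integral hk t).mul hf).intervalIntegrable a b

theorem dampedPrimitive_nonneg (hf0 : ∀ t, 0 < f t) {a t : ℝ} (hat : a ≤ t) :
    0 ≤ dampedPrimitive k f a t :=
  intervalIntegral.integral_nonneg hat fun s _ => mul_nonneg (Real.exp_pos _).le (hf0 s).le

theorem dampedPrimitive_anti_left (hk : Continuous k) (hf : Continuous f) (hf0 : ∀ t, 0 < f t)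
    {a b t : ℝ} (hab : a ≤ b) : dampedPrimitive k f b t ≤ dampedPrimitive k f a t := by
  rw [dampedPrimitive, dampedPrimitive, ← intervalIntegral.integral_add_adjacent_intervals
    (intervalIntegrable_dampedPrimitive hk hf t a b)
    (intervalIntegrable_dampedPrimitive hk hf t b t)]
  have := intervalIntegral.integral_nonneg (μ := volume) hab
    (f := fun s => Real.exp (-2 * ∫ τ in s..t, k τ) * f s)
    fun s _ => mul_nonneg (Real.exp_pos _).le (hf0 s).le
  linarith

/-- As `k / f` is nonincreasing, the damping never wins: `W` stays below its equilibrium value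
`f / (2 k)`, hence `W' ≥ 0`. -/
theorem two_mul_dampedPrimitive_le (hk : Continuous k) (hf : Continuous f) (hf0 : ∀ t, 0 < f t)
    (hkf : ∀ s t, s ≤ t → k t * f s ≤ k s * f t) {a t : ℝ} (hat : a ≤ t) :
    2 * k t * dampedPrimitive k f a t ≤ f t := by
  have hexp : ∀ s, HasDerivAt (fun s => Real.exp (-2 * ∫ τ in s..t, k τ))
      (Real.exp (-2 * ∫ τ in s..t, k τ) * (2 * k s)) s := by
    intro s
    have h1 : HasDerivAt (fun s => ∫ τ in s..t, k τ) (-k s) s :=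
      intervalIntegral.integral_hasDerivAt_left (hk.intervalIntegrable s t)
        (hk.stronglyMeasurableAtFilter _ _) hk.continuousAt
    have h2 := (h1.const_mul (-2)).exp
    convert h2 using 1
    ring
  have hec := continuous_exp_neg_two_integral hk t
  have hint : ∫ s in a..t, Real.exp (-2 * ∫ τ in s..t, k τ) * (2 * k s)
      = 1 - Real.exp (-2 * ∫ τ in a..t, k τ) := by
    rw [intervalIntegral.integral_eq_sub_of_hasDerivAt (fun s _ => hexp s)
      ((by fun_prop : Continuous _).intervalIntegrable _ _)]
    simp
  have hle : 2 * k t * dampedPrimitive k f a t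
      ≤ ∫ s in a..t, f t * (Real.exp (-2 * ∫ τ in s..t, k τ) * (2 * k s)) := by
    rw [dampedPrimitive, ← intervalIntegral.integral_const_mul]
    refine intervalIntegral.integral_mono_on hat ((by fun_prop : Continuous _).intervalIntegrable _ _)
      ((by fun_prop : Continuous _).intervalIntegrable _ _) fun s hs => ?_
    have h1 := hkf s t hs.2
    have h2 := Real.exp_pos (-2 * ∫ τ in s..t, k τ)
    nlinarith
  rw [intervalIntegral.integral_const_mul, hint] at hle
  have := mul_pos (hf0 t) (Real.exp_pos (-2 * ∫ τ in a..t, k τ))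
  linarith

theorem isEnergy_const_mul_dampedPrimitive (hk : Continuous k) (hf : Continuous f)
    (hf0 : ∀ t, 0 < f t) (hkf : ∀ s t, s ≤ t → k t * f s ≤ k s * f t) {c : ℝ} (hc : 0 < c)
    (a : ℝ) : IsEnergy (fun t => c * dampedPrimitive k f a t)
      (fun t => c * (f t - 2 * k t * dampedPrimitive k f a t)) a where
  hasDerivAt t := (hasDerivAt_dampedPrimitive hk hf a t).const_mul c
  continuous_deriv := by
    have : Continuous (dampedPrimitive k f a) :=
      continuous_iff_continuousAt.2 fun t => (hasDerivAt_dampedPrimitive hk hf a t).continuousAt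
    fun_prop
  apply_base := by rw [dampedPrimitive_base, mul_zero]
  deriv_base_pos := by
    rw [dampedPrimitive_base, mul_zero, sub_zero]; exact mul_pos hc (hf0 a)
  deriv_nonneg t ht :=
    mul_nonneg hc.le (sub_nonneg.2 (two_mul_dampedPrimitive_le hk hf hf0 hkf ht))

end DampedPrimitive

/-! ### Nonpositive `g` -/

/-- The damping coefficient `k = (g⁻ / f)^{2/q} f`. It is chosen so that the linear equation
`(p²)' / 2 = f - k p²` and the original one, `(p²)' / 2 = f - g⁻ p^q`, have the same equilibrium
value `p² = (f / g⁻)^{2/q}`. -/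
noncomputable def damping (f g : ℝ → ℝ) (q t : ℝ) : ℝ := (max (-g t) 0 / f t) ^ (2 / q) * f t

section Damping

variable {f g : ℝ → ℝ} {q : ℝ}

theorem continuous_damping (hq0 : 0 < q) (hf : Continuous f) (hf0 : ∀ t, 0 < f t)
    (hg : Continuous g) : Continuous (damping f g q) := by
  refine Continuous.mul (Continuous.rpow_const ?_ fun _ => Or.inr (by positivity)) hf
  exact (hg.neg.max continuous_const).div hf fun t => (hf0 t).ne'

theorem damping_nonneg (hf0 : ∀ t, 0 < f t) (t : ℝ) : 0 ≤ damping f g q t :=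
  mul_nonneg (Real.rpow_nonneg (div_nonneg (le_max_right _ _) (hf0 t).le) _) (hf0 t).le

theorem negPart_div_antitone (hf0 : ∀ t, 0 < f t) (hf : Monotone f) (hg : Monotone g) :
    Antitone fun t => max (-g t) 0 / f t := fun s _ hst =>
  div_le_div₀ (le_max_right _ _) (max_le_max (neg_le_neg (hg hst)) le_rfl) (hf0 s) (hf hst)

theorem damping_mul_le (hq0 : 0 < q) (hf0 : ∀ t, 0 < f t) (hf : Monotone f) (hg : Monotone g)
    (s t : ℝ) (hst : s ≤ t) : damping f g q t * f s ≤ damping f g q s * f t := by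
  have h1 : (max (-g t) 0 / f t) ^ (2 / q) ≤ (max (-g s) 0 / f s) ^ (2 / q) :=
    Real.rpow_le_rpow (div_nonneg (le_max_right _ _) (hf0 t).le)
      (negPart_div_antitone hf0 hf hg hst) (by positivity)
  have h2 := mul_le_mul_of_nonneg_right h1 (mul_pos (hf0 s) (hf0 t)).le
  rw [damping, damping]
  linarith

theorem damping_antitone (hq0 : 0 < q) (hq2 : q ≤ 2) (hf0 : ∀ t, 0 < f t) (hf : Monotone f)
    (hg : Monotone g) : Antitone (damping f g q) := by
  have hr : 0 ≤ 2 / q - 1 := by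
    rw [sub_nonneg, le_div_iff₀ hq0]; linarith
  have hform : ∀ t, damping f g q t = (max (-g t) 0 / f t) ^ (2 / q - 1) * max (-g t) 0 := by
    intro t
    have hx : 0 ≤ max (-g t) 0 / f t := div_nonneg (le_max_right _ _) (hf0 t).le
    have h1 := Real.rpow_add_one' hx (y := 2 / q - 1) (by rw [sub_add_cancel]; positivity)
    rw [sub_add_cancel] at h1
    rw [damping, h1, mul_assoc, div_mul_cancel₀ _ (hf0 t).ne']
  intro s t hst
  rw [hform, hform]
  refine mul_le_mul ?_ (max_le_max (neg_le_neg (hg hst)) le_rfl) (le_max_right _ _)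
    (Real.rpow_nonneg (div_nonneg (le_max_right _ _) (hf0 s).le) _)
  exact Real.rpow_le_rpow (div_nonneg (le_max_right _ _) (hf0 t).le)
    (negPart_div_antitone hf0 hf hg hst) hr

/-- In terms of the single quantity `y = (g⁻ / f)^{1/q} |p|`, the gradient term `g⁻ |p|^q` is
`f y^q` while the linear damping `k p²` is `f y²`. -/
theorem exists_common_variable (hq0 : 0 < q) (hf0 : ∀ t, 0 < f t) (t : ℝ) {e : ℝ} (he : 0 ≤ e) :
    ∃ y, 0 ≤ y ∧ max (-g t) 0 * √e ^ q = f t * y ^ q ∧ damping f g q t * e = f t * y ^ 2 := by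
  have hx : 0 ≤ max (-g t) 0 / f t := div_nonneg (le_max_right _ _) (hf0 t).le
  refine ⟨(max (-g t) 0 / f t) ^ (1 / q) * √e, by positivity, ?_, ?_⟩
  · rw [Real.mul_rpow (by positivity) (by positivity), ← Real.rpow_mul hx,
      one_div_mul_cancel hq0.ne', Real.rpow_one, ← mul_assoc, mul_div_cancel₀ _ (hf0 t).ne']
  · rw [mul_pow, Real.sq_sqrt he, ← Real.rpow_natCast, ← Real.rpow_mul hx, damping]
    have : 1 / q * ((2 : ℕ) : ℝ) = 2 / q := by push_cast; ring
    rw [this]; ring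

variable (hq0 : 0 < q) (hq2 : q ≤ 2) (hf_cont : Continuous f) (hf0 : ∀ t, 0 < f t)
  (hf : Monotone f) (hg_cont : Continuous g) (hg : Monotone g)

include hq0 hq2 hf_cont hf0 hf hg_cont hg in
theorem dampedPrimitive_subsolution {a t : ℝ} (hat : a ≤ t) (hgt : g t ≤ 0) :
    2 * (f t + g t * √(2 * dampedPrimitive (damping f g q) f a t) ^ q)
      ≤ 2 * (f t - 2 * damping f g q t * dampedPrimitive (damping f g q) f a t) := by
  set W := dampedPrimitive (damping f g q) f a t with hW
  have hW0 : 0 ≤ W := dampedPrimitive_nonneg hf0 hat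
  have hkW : 2 * damping f g q t * W ≤ f t := two_mul_dampedPrimitive_le
    (continuous_damping hq0 hf_cont hf0 hg_cont) hf_cont hf0 (damping_mul_le hq0 hf0 hf hg) hat
  obtain ⟨y, hy0, h1, h2⟩ := exists_common_variable (g := g) hq0 hf0 t
    (show 0 ≤ 2 * W by positivity)
  rw [max_eq_left (by linarith)] at h1
  have hft := hf0 t
  have hy1 : y ≤ 1 := by
    have : y ^ 2 ≤ 1 := by
      by_contra! hlt
      nlinarith
    nlinarith
  have hyq : y ^ 2 ≤ y ^ q := by
    rcases hy0.eq_or_lt with h0 | h0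
    · rw [← h0]; simp [Real.zero_rpow hq0.ne']
    · rw [← Real.rpow_natCast]
      exact Real.rpow_le_rpow_of_exponent_ge h0 hy1 (by exact_mod_cast hq2)
  nlinarith

include hq0 hq2 hf_cont hf0 hf hg_cont hg in
/-- A small multiple of `W` has room to spare for the dimensional constant in front of `f`. -/
theorem exists_dampedPrimitive_supersolution {n : ℕ} (hn : 1 ≤ n) :
    ∃ c > 0, ∀ a t, a ≤ t →
      c * (f t - 2 * damping f g q t * dampedPrimitive (damping f g q) f a t)
        ≤ 2 * (f t / n
          - max (-g t) 0 * √(c * dampedPrimitive (damping f g q) f a t) ^ q) := by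
  have hn1 : (1 : ℝ) ≤ n := by exact_mod_cast hn
  have hb0 : (0 : ℝ) < 1 / (2 * n) := by positivity
  have hb1 : 1 / (2 * n : ℝ) ≤ 1 := by
    rw [div_le_one (by positivity)]; linarith
  -- the largest value of `k E / f` along the barrier is `c / 2`
  set d : ℝ := (1 / (2 * n)) ^ (2 / q) with hd
  have hd0 : 0 < d := Real.rpow_pos_of_pos hb0 _
  have hdq : d ^ (q / 2) = 1 / (2 * n) := by
    rw [hd, ← Real.rpow_mul hb0.le, div_mul_div_cancel₀ hq0.ne', div_self two_ne_zero,
      Real.rpow_one]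
  have hdle : d ≤ 1 / (2 * n) := by
    have : (1 / (2 * n) : ℝ) ^ (2 / q) ≤ (1 / (2 * n) : ℝ) ^ (1 : ℝ) :=
      Real.rpow_le_rpow_of_exponent_ge hb0 hb1 (by rw [le_div_iff₀ hq0]; linarith)
    rwa [Real.rpow_one] at this
  refine ⟨2 * d, by positivity, fun a t hat => ?_⟩
  set W := dampedPrimitive (damping f g q) f a t with hW
  have hW0 : 0 ≤ W := dampedPrimitive_nonneg hf0 hat
  have hkW : 2 * damping f g q t * W ≤ f t := two_mul_dampedPrimitive_le
    (continuous_damping hq0 hf_cont hf0 hg_cont) hf_cont hf0 (damping_mul_le hq0 hf0 hf hg) hat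
  obtain ⟨y, hy0, h1, h2⟩ := exists_common_variable (g := g) hq0 hf0 t
    (show 0 ≤ 2 * d * W by positivity)
  have hft := hf0 t
  have hyd : y ^ 2 ≤ d := by
    have e1 : f t * y ^ 2 ≤ f t * d := by
      rw [← h2]; nlinarith
    exact le_of_mul_le_mul_left e1 hft
  have hyq : y ^ q ≤ 1 / (2 * n) := by
    have e1 : y ^ q = (y ^ 2) ^ (q / 2) := by
      rw [← Real.rpow_natCast, ← Real.rpow_mul hy0]
      congr 1; push_cast; ring
    rw [e1, ← hdq]
    exact Real.rpow_le_rpow (by positivity) hyd (by positivity)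
  rw [h1]
  have e2 : f t / n = f t * (1 / (2 * n)) + f t * (1 / (2 * n)) := by field_simp; ring
  rw [e2]
  have e3 : 0 ≤ damping f g q t * (2 * d * W) :=
    mul_nonneg (damping_nonneg hf0 t) (by positivity)
  have e4 := mul_le_mul_of_nonneg_left hyq hft.le
  have e5 := mul_le_mul_of_nonneg_left hdle hft.le
  nlinarith

theorem dampedPrimitive_pos {k : ℝ → ℝ} (hk : Continuous k) (hf_cont : Continuous f)
    (hf0 : ∀ t, 0 < f t) {a t : ℝ} (hat : a < t) : 0 < dampedPrimitive k f a t :=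
  intervalIntegral.intervalIntegral_pos_of_pos_on
    (intervalIntegrable_dampedPrimitive hk hf_cont t a t)
    (fun s _ => mul_pos (Real.exp_pos _) (hf0 s)) hat

include hq0 hq2 hf_cont hf0 hg_cont hg in
/-- When `g ≤ 0`, a constant multiple of `W` serves both as subsolution and as barrier. -/
theorem exists_subsolution_iff_kellerOssermanZero {n : ℕ} (hn : 1 ≤ n) (hf' : StrictMono f)
    (hg0 : ∀ t, g t ≤ 0) :
    (∃ u : EuclideanSpace ℝ (Fin n) → ℝ, IsEntireViscositySubsolution f g q u) ↔
      KellerOssermanZero f g q := by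
  have hf := hf'.monotone
  have hk := continuous_damping hq0 hf_cont hf0 hg_cont
  have hkf := damping_mul_le hq0 hf0 hf hg
  have hKO : KellerOssermanZero f g q ↔ ∫⁻ t in Ioi (0 : ℝ), ENNReal.ofReal
    (1 / dampedPrimitive (damping f g q) f 0 t ^ (1 / 2 : ℝ)) = ⊤ := Iff.rfl
  rw [hKO]
  simp only [← Real.sqrt_eq_rpow]
  constructor
  · rintro ⟨u, hu⟩
    by_contra hfin
    set a := min 0 (u 0 - 1) with ha
    have ha0 : a ≤ 0 := min_le_left _ _
    obtain ⟨c, hc, hsup⟩ :=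
      exists_dampedPrimitive_supersolution hq0 hq2 hf_cont hf0 hf hg_cont hg hn
    have hE := isEnergy_const_mul_dampedPrimitive hk hf_cont hf0 hkf hc a
    obtain ⟨B, hB⟩ := hE.exists_travelTime_le_of_lintegral_ne_top ha0 (by
      refine lintegral_Ioi_ne_top_of_le (c := 1) (C := (√c)⁻¹) one_pos (by positivity)
        (fun t ht => ?_) (by rwa [one_mul])
      have h1 : 0 < dampedPrimitive (damping f g q) f 0 t := dampedPrimitive_pos hk hf_cont hf0 ht
      rw [one_mul, Real.sqrt_mul hc.le, mul_inv, one_div]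
      have h2 := Real.sqrt_le_sqrt (dampedPrimitive_anti_left (t := t) hk hf_cont hf0 ha0)
      have h3 := inv_anti₀ (Real.sqrt_pos.2 h1) h2
      gcongr)
    have := hE.apply_zero_le_of_subsolution hn hq0 hq2 hf' hg hB (fun t hat => by
      have := hsup a t hat
      rw [max_eq_right (hg0 t), zero_div, zero_sub, neg_mul, ← sub_eq_add_neg]
      exact this) hu
    have h2 : a ≤ u 0 - 1 := min_le_right _ _
    linarith
  · intro htop
    have hE := isEnergy_const_mul_dampedPrimitive hk hf_cont hf0 hkf two_pos 0
    refine hE.exists_subsolution hn (hE.mem_reachedTimes_of_lintegral_eq_top ?_) fun t ht =>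
      dampedPrimitive_subsolution hq0 hq2 hf_cont hf0 hf hg_cont hg ht (hg0 t)
    by_contra hfin
    refine lintegral_Ioi_ne_top_of_le (b := 0) (c := 1) (C := √2) one_pos (by positivity)
      (fun t ht => ?_) (by rwa [one_mul]) htop
    rw [one_mul, Real.sqrt_mul two_pos.le, mul_inv, one_div, ← mul_assoc,
      mul_inv_cancel₀ (by positivity), one_mul]

include hq0 hq2 hf_cont hf0 hf hg_cont hg in
/-- When `g` is bounded away from `0`, it is also bounded on `[0, ∞)` by monotonicity, and `W(t)` is
comparable with the minimum of `t f` and `f^{2/q}`, up to halving `t`. -/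
theorem kellerOssermanZero_iff_kellerOssermanNeg {m : ℝ} (hm : 0 < m) (hgm : ∀ t, g t ≤ -m) :
    KellerOssermanZero f g q ↔ KellerOssermanNeg f q := by
  have hk := continuous_damping hq0 hf_cont hf0 hg_cont
  have hkf := damping_mul_le hq0 hf0 hf hg
  have hk0 : ∀ t, 0 ≤ damping f g q t := damping_nonneg hf0
  have hKO : KellerOssermanZero f g q ↔ ∫⁻ t in Ioi (0 : ℝ), ENNReal.ofReal
    (1 / dampedPrimitive (damping f g q) f 0 t ^ (1 / 2 : ℝ)) = ⊤ := Iff.rfl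
  rw [hKO, KellerOssermanNeg]
  simp only [← Real.sqrt_eq_rpow]
  set W := dampedPrimitive (damping f g q) f 0 with hW
  rw [← not_iff_not]
  constructor
  · intro hfin
    refine lintegral_Ioi_ne_top_of_le (c := 1) (b := 0) (C := 1 + (m ^ (1 / q))⁻¹) one_pos
      (by positivity) (fun t ht => ?_) (by rwa [one_mul])
    have hft := hf0 t
    have hWpos : 0 < W t := dampedPrimitive_pos hk hf_cont hf0 ht
    have hsW : 0 < √(W t) := Real.sqrt_pos.2 hWpos
    have hle1 : W t ≤ t * f t := by
      have : W t ≤ ∫ _s in (0 : ℝ)..t, f t := by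
        refine intervalIntegral.integral_mono_on ht.le
          (intervalIntegrable_dampedPrimitive hk hf_cont t 0 t) intervalIntegrable_const
          fun s hs => ?_
        have h1 : Real.exp (-2 * ∫ τ in s..t, damping f g q τ) ≤ 1 := by
          rw [Real.exp_le_one_iff]
          have := intervalIntegral.integral_nonneg (μ := volume) hs.2 fun τ _ => hk0 τ
          linarith
        have h2 := hf hs.2
        have h3 := hf0 s
        nlinarith
      simpa using this
    have hle2 : m ^ (1 / q) * √(W t) ≤ f t ^ (1 / q) := by
      obtain ⟨y, hy0, h1, h2⟩ := exists_common_variable (g := g) hq0 hf0 t hWpos.le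
      have hkW : 2 * damping f g q t * W t ≤ f t :=
        two_mul_dampedPrimitive_le hk hf_cont hf0 hkf ht.le
      have hy1 : y ≤ 1 := by
        have : y ^ 2 ≤ 1 := by
          by_contra! hlt
          nlinarith
        nlinarith
      have hyq : y ^ q ≤ 1 := Real.rpow_le_one hy0 hy1 hq0.le
      have h3 : m * √(W t) ^ q ≤ f t := by
        have e1 : m ≤ max (-g t) 0 := le_max_of_le_left (by linarith [hgm t])
        have e2 : 0 ≤ √(W t) ^ q := by positivity
        nlinarith
      have h4 := Real.rpow_le_rpow (by positivity) h3 (show 0 ≤ 1 / q by positivity)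
      rwa [Real.mul_rpow hm.le (by positivity), ← Real.rpow_mul hsW.le,
        mul_one_div_cancel hq0.ne', Real.rpow_one] at h4
    have hmq : 0 < m ^ (1 / q) := by positivity
    have i1 : 1 / √(t * f t) ≤ 1 / √(W t) :=
      one_div_le_one_div_of_le hsW (Real.sqrt_le_sqrt hle1)
    have i2 : 1 / f t ^ (1 / q) ≤ (m ^ (1 / q))⁻¹ * (1 / √(W t)) := by
      rw [← one_div, one_div_mul_one_div]
      exact one_div_le_one_div_of_le (by positivity) hle2
    rw [one_mul, add_mul, one_mul]
    exact add_le_add i1 i2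
  · intro hfin
    refine lintegral_Ioi_ne_top_of_le (c := 1 / 2) (b := 0)
      (C := Real.exp 1 * (1 + (max (-g 0) 0) ^ (1 / q))) (by norm_num) (by positivity)
      (fun t ht => ?_) (by rwa [mul_zero])
    set τ : ℝ := 1 / 2 * t with hτ
    have hτ0 : 0 < τ := by positivity
    have hfτ := hf0 τ
    set κ := damping f g q τ with hκ
    have hκ0 : 0 ≤ κ := hk0 τ
    -- on an interval of this length the damping loses at most the factor `e⁻²`
    set δ := τ / (1 + κ * τ) with hδ
    have hden : 0 < 1 + κ * τ := by positivity
    have hδ0 : 0 < δ := by positivity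
    have hδτ : δ ≤ τ := div_le_self hτ0.le (by nlinarith)
    have hκδ : κ * δ ≤ 1 := by
      rw [hδ, ← mul_div_assoc, div_le_one hden]; linarith
    have hlow : δ * (Real.exp (-2) * f τ) ≤ W t := by
      have h1 : dampedPrimitive (damping f g q) f (t - δ) t ≤ W t :=
        dampedPrimitive_anti_left hk hf_cont hf0 (by linarith)
      refine le_trans ?_ h1
      have h2 : ∫ _s in (t - δ)..t, Real.exp (-2) * f τ
          ≤ dampedPrimitive (damping f g q) f (t - δ) t := by
        refine intervalIntegral.integral_mono_on (by linarith) intervalIntegrable_const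
          (intervalIntegrable_dampedPrimitive hk hf_cont t _ t) fun s hs => ?_
        have hτs : τ ≤ s := by linarith [hs.1]
        have h3 : ∫ r in s..t, damping f g q r ≤ ∫ _r in s..t, κ :=
          intervalIntegral.integral_mono_on hs.2 (hk.intervalIntegrable _ _)
            intervalIntegrable_const fun r hr =>
            damping_antitone hq0 hq2 hf0 hf hg (hτs.trans hr.1)
        rw [intervalIntegral.integral_const, smul_eq_mul] at h3
        have h4 : (t - s) * κ ≤ 1 := by
          have : t - s ≤ δ := by linarith [hs.1]
          nlinarith
        exact mul_le_mul (Real.exp_le_exp.2 (by linarith)) (hf hτs) (hf0 τ).le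
          (Real.exp_pos _).le
      rwa [intervalIntegral.integral_const, sub_sub_cancel, smul_eq_mul] at h2
    have hsq : (√(W t))⁻¹ ≤ Real.exp 1 * √(1 / (τ * f τ) + κ / f τ) := by
      have h1 : δ * (Real.exp (-2) * f τ) = (Real.exp 1 ^ 2 * (1 / (τ * f τ) + κ / f τ))⁻¹ := by
        rw [← Real.exp_nat_mul, hδ]
        have : Real.exp (-2) = (Real.exp ((2 : ℕ) * 1))⁻¹ := by rw [← Real.exp_neg]; norm_num
        rw [this]
        field_simp
      have h2 : (√(W t))⁻¹ ≤ (√(Real.exp 1 ^ 2 * (1 / (τ * f τ) + κ / f τ))⁻¹)⁻¹ :=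
        inv_anti₀ (Real.sqrt_pos.2 (by positivity)) (Real.sqrt_le_sqrt (h1 ▸ hlow))
      rwa [Real.sqrt_inv, inv_inv, Real.sqrt_mul (by positivity),
        Real.sqrt_sq (Real.exp_pos 1).le] at h2
    have hκf : √(κ / f τ) ≤ max (-g 0) 0 ^ (1 / q) / f τ ^ (1 / q) := by
      have hx : 0 ≤ max (-g τ) 0 / f τ := div_nonneg (le_max_right _ _) hfτ.le
      have e1 : κ / f τ = ((max (-g τ) 0 / f τ) ^ (1 / q)) ^ 2 := by
        rw [hκ, damping, mul_div_cancel_right₀ _ hfτ.ne', ← Real.rpow_natCast, ← Real.rpow_mul hx]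
        congr 1; push_cast; ring
      rw [e1, Real.sqrt_sq (by positivity), ← Real.div_rpow (le_max_right _ _) hfτ.le]
      refine Real.rpow_le_rpow hx ?_ (by positivity)
      gcongr
      exact hg hτ0.le
    have hadd : √(1 / (τ * f τ) + κ / f τ) ≤ √(1 / (τ * f τ)) + √(κ / f τ) :=
      Real.sqrt_le_iff.2 ⟨by positivity, by
        have e1 := Real.sq_sqrt (show 0 ≤ 1 / (τ * f τ) by positivity)
        have e2 := Real.sq_sqrt (show 0 ≤ κ / f τ by positivity)
        nlinarith [mul_nonneg (Real.sqrt_nonneg (1 / (τ * f τ))) (Real.sqrt_nonneg (κ / f τ))]⟩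
    rw [one_div (√(W t))]
    refine hsq.trans ?_
    rw [mul_assoc (Real.exp 1) (1 + max (-g 0) 0 ^ (1 / q))]
    refine mul_le_mul_of_nonneg_left ?_ (Real.exp_pos 1).le
    refine hadd.trans ?_
    have hM : 0 ≤ max (-g 0) 0 ^ (1 / q) := by positivity
    have j1 : 0 ≤ 1 / √(τ * f τ) := by positivity
    have j2 : 0 ≤ 1 / f τ ^ (1 / q) := by positivity
    rw [Real.sqrt_div zero_le_one, Real.sqrt_one]
    have j3 : max (-g 0) 0 ^ (1 / q) / f τ ^ (1 / q)
        = max (-g 0) 0 ^ (1 / q) * (1 / f τ ^ (1 / q)) := by ring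
    rw [j3] at hκf
    nlinarith [mul_nonneg hM j1]

end Damping

/-! ### Eventually positive `g` -/

section Doubling

variable {h : ℝ → ℝ}

theorem hasDerivAt_integral_doubling (hh : Continuous h) (t : ℝ) :
    HasDerivAt (fun t => ∫ s in t..2 * t, h s) (2 * h (2 * t) - h t) t := by
  have h1 : HasDerivAt (fun t : ℝ => 2 * t) 2 t := by
    simpa using (hasDerivAt_id t).const_mul (2 : ℝ)
  have h2 := ((hasDerivAt_primitive hh 0 (2 * t)).comp t h1).sub (hasDerivAt_primitive hh 0 t)
  rw [mul_comm 2 (h (2 * t))]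
  refine h2.congr_of_eventuallyEq (Eventually.of_forall fun t => ?_)
  exact (intervalIntegral.integral_interval_sub_left (hh.intervalIntegrable 0 _)
    (hh.intervalIntegrable 0 _)).symm

theorem mul_le_integral_of_monotone (hh : Continuous h) (hm : Monotone h) {s t : ℝ}
    (hst : s ≤ t) : (t - s) * h s ≤ ∫ r in s..t, h r := by
  have := intervalIntegral.integral_mono_on (μ := volume) hst intervalIntegrable_const
    (hh.intervalIntegrable s t) fun r hr => hm hr.1
  rwa [intervalIntegral.integral_const, smul_eq_mul] at this

theorem integral_le_mul_of_monotone (hh : Continuous h) (hm : Monotone h) {s t : ℝ}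
    (hst : s ≤ t) : ∫ r in s..t, h r ≤ (t - s) * h t := by
  have := intervalIntegral.integral_mono_on (μ := volume) hst (hh.intervalIntegrable s t)
    intervalIntegrable_const fun r hr => hm hr.2
  rwa [intervalIntegral.integral_const, smul_eq_mul] at this

end Doubling

section PositiveLimit

variable {f g : ℝ → ℝ} {q : ℝ}

/-- If `1 + q/2 · p = p`, i.e. `p = 2 / (2 - q)`, then `H^p` solves `E' = p H' E^{q/2}`. -/
theorem two_div_two_sub_mul (hq2 : q < 2) : 2 / (2 - q) * (q / 2) = 2 / (2 - q) - 1 := by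
  have : 2 - q ≠ 0 := by linarith
  field_simp
  ring

/-- The interaction between the two sources of growth: with `P = ∫_t^{2t} f`, `H = ∫_t^{2t} g⁺`,
whichever of `P` and `H^p` is larger, its contribution to the gradient term is controlled. -/
theorem gradient_term_le {t P H f₂ g₁ g₂ : ℝ} (hq0 : 0 < q) (hq2 : q < 2) (ht : 0 ≤ t)
    (hP : 0 ≤ P) (hH : 0 ≤ H) (hf₂ : 0 ≤ f₂) (hg₁ : 0 ≤ g₁) (hg₁₂ : g₁ ≤ g₂)
    (hPf : P ≤ t * f₂) (hHg : t * g₁ ≤ H) :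
    g₁ * max P (H ^ (2 / (2 - q))) ^ (q / 2) ≤ f₂ + g₂ * H ^ (2 / (2 - q) - 1) := by
  have h2q : 0 < 2 - q := by linarith
  have hH1 : 0 ≤ H ^ (2 / (2 - q) - 1) := by positivity
  have hg₂ := hg₁.trans hg₁₂
  rcases le_total P (H ^ (2 / (2 - q))) with h | h
  · rw [max_eq_right h, ← Real.rpow_mul hH, two_div_two_sub_mul hq2]
    nlinarith
  · rw [max_eq_left h]
    have hPq : 0 ≤ P ^ (q / 2) := by positivity
    have key : g₁ * P ^ (q / 2) ≤ f₂ := by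
      rcases ht.eq_or_lt with h0 | h0
      · have : P = 0 := le_antisymm (by rw [← h0, zero_mul] at hPf; exact hPf) hP
        rw [this, Real.zero_rpow (by positivity), mul_zero]
        exact hf₂
      · have h1 : H ≤ P ^ (1 - q / 2) := by
          have := Real.rpow_le_rpow (by positivity) h (show 0 ≤ 1 - q / 2 by linarith)
          rwa [← Real.rpow_mul hH, show 2 / (2 - q) * (1 - q / 2) = 1 by field_simp,
            Real.rpow_one] at this
        have h2 : P ^ (1 - q / 2) * P ^ (q / 2) = P := by
          rw [← Real.rpow_add' hP (by norm_num), sub_add_cancel, Real.rpow_one]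
        have h3 : t * (g₁ * P ^ (q / 2)) ≤ t * f₂ := by nlinarith
        exact le_of_mul_le_mul_left h3 h0
    have := mul_nonneg hg₂ hH1
    linarith

/-- For `q ≤ 1` the explicit energy `25 (P + H^p)`, `P = ∫_t^{2t} f`, `H = ∫_t^{2t} g⁺`,
`p = 2 / (2 - q)`, is large enough to be a subsolution: its gradient term `g E^{q/2}` is at most
`10 (f(2t) + g⁺(2t) H^{p-1})`, and `2 + 2 * 10 ≤ 25`. -/
theorem exists_subsolution_of_kellerOssermanPos {n : ℕ} (hn : 1 ≤ n) (hq0 : 0 < q)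
    (hf_cont : Continuous f) (hf0 : ∀ t, 0 < f t) (hf : Monotone f)
    (hg_cont : Continuous g) (hg : Monotone g) (hKO : KellerOssermanPos f g q) :
    ∃ u : EuclideanSpace ℝ (Fin n) → ℝ, IsEntireViscositySubsolution f g q u := by
  obtain ⟨hq1, htop⟩ := hKO
  have h2q : 0 < 2 - q := by linarith
  set p := 2 / (2 - q) with hp
  have hp1 : 1 ≤ p := by rw [hp, le_div_iff₀ h2q]; linarith
  have hpq := two_div_two_sub_mul (show q < 2 by linarith)
  rw [← hp] at hpq
  set G : ℝ → ℝ := fun t => max (g t) 0 with hG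
  have hGc : Continuous G := hg_cont.max continuous_const
  have hGm : Monotone G := fun s t hst => max_le_max (hg hst) le_rfl
  have hG0 : ∀ t, 0 ≤ G t := fun t => le_max_right _ _
  set P : ℝ → ℝ := fun t => ∫ s in t..2 * t, f s with hP
  set H : ℝ → ℝ := fun t => ∫ s in t..2 * t, G s with hH
  have hPd : ∀ t, HasDerivAt P (2 * f (2 * t) - f t) t := hasDerivAt_integral_doubling hf_cont
  have hHd : ∀ t, HasDerivAt H (2 * G (2 * t) - G t) t := hasDerivAt_integral_doubling hGc
  have hHcont : Continuous H := continuous_iff_continuousAt.2 fun t => (hHd t).continuousAt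
  have hPl : ∀ t, 0 ≤ t → t * f t ≤ P t := fun t ht => by
    have := mul_le_integral_of_monotone hf_cont hf (show t ≤ 2 * t by linarith)
    rwa [show 2 * t - t = t by ring] at this
  have hPu : ∀ t, 0 ≤ t → P t ≤ t * f (2 * t) := fun t ht => by
    have := integral_le_mul_of_monotone hf_cont hf (show t ≤ 2 * t by linarith)
    rwa [show 2 * t - t = t by ring] at this
  have hHl : ∀ t, 0 ≤ t → t * G t ≤ H t := fun t ht => by
    have := mul_le_integral_of_monotone hGc hGm (show t ≤ 2 * t by linarith)
    rwa [show 2 * t - t = t by ring] at this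
  have hHu : ∀ t, 0 ≤ t → H t ≤ t * G (2 * t) := fun t ht => by
    have := integral_le_mul_of_monotone hGc hGm (show t ≤ 2 * t by linarith)
    rwa [show 2 * t - t = t by ring] at this
  have hP0 : ∀ t, 0 ≤ t → 0 ≤ P t := fun t ht => (mul_nonneg ht (hf0 t).le).trans (hPl t ht)
  have hH0 : ∀ t, 0 ≤ t → 0 ≤ H t := fun t ht => (mul_nonneg ht (hG0 t)).trans (hHl t ht)
  set E' : ℝ → ℝ := fun t => 25 * ((2 * f (2 * t) - f t) +
    (2 * G (2 * t) - G t) * p * H t ^ (p - 1)) with hE'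
  have hlow : ∀ t, 0 ≤ t → 25 * (f (2 * t) + G (2 * t) * H t ^ (p - 1)) ≤ E' t := by
    intro t ht
    have h1 : f t ≤ f (2 * t) := hf (by linarith)
    have h2 : G t ≤ G (2 * t) := hGm (by linarith)
    have h3 : 0 ≤ H t ^ (p - 1) := Real.rpow_nonneg (hH0 t ht) _
    have h4 : G (2 * t) * H t ^ (p - 1) ≤ (2 * G (2 * t) - G t) * p * H t ^ (p - 1) := by
      refine mul_le_mul_of_nonneg_right ?_ h3
      nlinarith [hG0 (2 * t)]
    rw [hE']
    beta_reduce
    linarith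
  have hE : IsEnergy (fun t => 25 * (P t + H t ^ p)) E' 0 := by
    refine ⟨fun t => ?_, ?_, ?_, ?_, fun t ht => ?_⟩
    · exact ((hPd t).add ((hHd t).rpow_const (Or.inr hp1))).const_mul 25
    · have : Continuous fun t => H t ^ (p - 1) :=
        hHcont.rpow_const fun _ => Or.inr (by linarith)
      fun_prop
    · simp [hP, hH, Real.zero_rpow (show p ≠ 0 by linarith)]
    · refine lt_of_lt_of_le ?_ (hlow 0 le_rfl)
      have h1 := mul_nonneg (hG0 (2 * 0)) (Real.rpow_nonneg (hH0 0 le_rfl) (p - 1))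
      have h2 := hf0 (2 * 0)
      linarith
    · refine le_trans ?_ (hlow t ht)
      have h1 := mul_nonneg (hG0 (2 * t)) (Real.rpow_nonneg (hH0 t ht) (p - 1))
      have h2 := hf0 (2 * t)
      linarith
  refine hE.exists_subsolution hn (hE.mem_reachedTimes_of_lintegral_eq_top ?_) fun t ht => ?_
  · by_contra hfin
    refine lintegral_Ioi_ne_top_of_le (b := 0) (c := 1 / 2) (C := 5) (by norm_num) (by norm_num)
      (fun s hs => ?_) (by rwa [mul_zero]) htop
    set t : ℝ := 1 / 2 * s with ht
    have ht0 : 0 ≤ t := by positivity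
    have hst : 2 * t = s := by rw [ht]; ring
    have hEpos := Real.sqrt_pos.2 (hE.pos (show 0 < t by positivity))
    have a1 : √(P t) ≤ (s * f s) ^ (1 / 2 : ℝ) := by
      rw [← Real.sqrt_eq_rpow]
      refine Real.sqrt_le_sqrt ((hPu t ht0).trans ?_)
      rw [hst]
      have := hf0 s
      gcongr
      linarith
    have a2 : √(H t ^ p) ≤ (s * G s) ^ (1 / (2 - q)) := by
      rw [Real.sqrt_eq_rpow, ← Real.rpow_mul (hH0 t ht0),
        show p * (1 / 2) = 1 / (2 - q) by rw [hp]; field_simp]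
      refine Real.rpow_le_rpow (hH0 t ht0) ((hHu t ht0).trans ?_) (by positivity)
      rw [hst]
      have := hG0 s
      gcongr
      linarith
    have a3 : √(25 * (P t + H t ^ p)) ≤ 5 * (√(P t) + √(H t ^ p)) := by
      have e1 := Real.sq_sqrt (hP0 t ht0)
      have e2 := Real.sq_sqrt (Real.rpow_nonneg (hH0 t ht0) p)
      exact Real.sqrt_le_iff.2 ⟨by positivity, by
        nlinarith [mul_nonneg (Real.sqrt_nonneg (P t)) (Real.sqrt_nonneg (H t ^ p))]⟩
    rw [← div_eq_mul_inv]
    have a4 : 0 < (s * f s) ^ (1 / 2 : ℝ) + (s * G s) ^ (1 / (2 - q)) := by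
      have := hf0 s
      have h1 : 0 < (s * f s) ^ (1 / 2 : ℝ) := by positivity
      have h2 : 0 ≤ (s * G s) ^ (1 / (2 - q)) := Real.rpow_nonneg (mul_nonneg hs.le (hG0 s)) _
      linarith
    rw [div_le_div_iff₀ a4 hEpos]
    linarith
  · refine le_trans ?_ (hlow t ht)
    set Q := max (P t) (H t ^ p) with hQ
    have hQ0 : 0 ≤ Q := le_max_of_le_left (hP0 t ht)
    have h1 : √(25 * (P t + H t ^ p)) ^ q ≤ 10 * Q ^ (q / 2) := by
      have e1 : √(25 * (P t + H t ^ p)) ≤ 10 * √Q := by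
        refine Real.sqrt_le_iff.2 ⟨by positivity, ?_⟩
        rw [mul_pow, Real.sq_sqrt hQ0]
        linarith [le_max_left (P t) (H t ^ p), le_max_right (P t) (H t ^ p)]
      refine (Real.rpow_le_rpow (Real.sqrt_nonneg _) e1 hq0.le).trans ?_
      rw [Real.mul_rpow (by norm_num) (Real.sqrt_nonneg _), Real.sqrt_eq_rpow, ← Real.rpow_mul hQ0,
        show 1 / 2 * q = q / 2 by ring]
      refine mul_le_mul_of_nonneg_right ?_ (by positivity)
      have : (10 : ℝ) ^ q ≤ (10 : ℝ) ^ (1 : ℝ) :=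
        Real.rpow_le_rpow_of_exponent_le (by norm_num) hq1
      rwa [Real.rpow_one] at this
    have h2 := gradient_term_le hq0 (show q < 2 by linarith) ht (hP0 t ht) (hH0 t ht)
      (hf0 (2 * t)).le (hG0 t) (hGm (show t ≤ 2 * t by linarith)) (hPu t ht) (hHl t ht)
    have h3 : g t * √(25 * (P t + H t ^ p)) ^ q ≤ G t * (10 * Q ^ (q / 2)) :=
      mul_le_mul (le_max_left _ _) h1 (by positivity) (hG0 t)
    have h4 : f t ≤ f (2 * t) := hf (by linarith)
    have h5 := mul_nonneg (hG0 (2 * t)) (Real.rpow_nonneg (hH0 t ht) (p - 1))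
    rw [← hp, ← hQ] at h2
    nlinarith [hf0 (2 * t)]

theorem mul_le_dampedPrimitive (hq0 : 0 < q) (hf_cont : Continuous f) (hf0 : ∀ t, 0 < f t)
    (hf : Monotone f) (hg_cont : Continuous g) (hg : Monotone g) {a b t : ℝ} (hab : a ≤ b)
    (hbt : b ≤ t) (hgb : 0 ≤ g b) :
    (t - b) * f b ≤ dampedPrimitive (damping f g q) f a t := by
  have hk := continuous_damping hq0 hf_cont hf0 hg_cont
  refine le_trans ?_ (dampedPrimitive_anti_left hk hf_cont hf0 hab)
  refine (mul_le_integral_of_monotone hf_cont hf hbt).trans (le_of_eq ?_)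
  refine intervalIntegral.integral_congr fun s hs => ?_
  rw [uIcc_of_le hbt] at hs
  have h0 : ∫ τ in s..t, damping f g q τ = 0 := by
    rw [intervalIntegral.integral_congr (g := fun _ => (0 : ℝ)) fun τ hτ => ?_]
    · simp
    · rw [uIcc_of_le hs.2] at hτ
      have : 0 ≤ g τ := hgb.trans (hg (hs.1.trans hτ.1))
      simp [damping, max_eq_right (neg_nonpos.2 this), Real.zero_rpow (show 2 / q ≠ 0 by positivity)]
  simp [h0]

/-- If `g` is eventually nonnegative, the barrier adds to `c W` a term `(κ H)^p` that exploits the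
gradient term with an exponent `r ≤ q`; lowering the exponent is harmless where the slope is at
least `1`. -/
theorem not_exists_subsolution_of_lintegral_ne_top {n : ℕ} (hn : 1 ≤ n) (hq0 : 0 < q)
    (hq2 : q ≤ 2) (hf_cont : Continuous f) (hf0 : ∀ t, 0 < f t) (hf' : StrictMono f)
    (hg_cont : Continuous g) (hg : Monotone g) {r t₀ T : ℝ} (hr0 : 0 < r) (hrq : r ≤ q)
    (hr2 : r < 2) (ht₀ : 0 ≤ g t₀)
    (hfin : ∫⁻ t in Ioi T, ENNReal.ofReal
      (1 / ((t * f t) ^ (1 / 2 : ℝ) + (t * max (g t) 0) ^ (1 / (2 - r)))) ≠ ⊤)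
    {u : EuclideanSpace ℝ (Fin n) → ℝ} (hu : IsEntireViscositySubsolution f g q u) : False := by
  have hf := hf'.monotone
  have hk := continuous_damping hq0 hf_cont hf0 hg_cont
  have hkf := damping_mul_le hq0 hf0 hf hg
  have h2r : 0 < 2 - r := by linarith
  set p := 2 / (2 - r) with hp
  have hp1 : 1 < p := by rw [hp, lt_div_iff₀ h2r]; linarith
  have hp0 : 0 < p := by linarith
  have hpr := two_div_two_sub_mul hr2
  rw [← hp] at hpr
  have hn0 : (0 : ℝ) < n := by exact_mod_cast hn
  set a := u 0 - 1 with ha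
  obtain ⟨c, hc, hsup⟩ :=
    exists_dampedPrimitive_supersolution hq0 hq2 hf_cont hf0 hf hg_cont hg hn
  set W := dampedPrimitive (damping f g q) f a with hW
  set b := max (max t₀ T) (max a 0) with hb
  have hbt₀ : t₀ ≤ b := (le_max_left _ _).trans (le_max_left _ _)
  have hbT : T ≤ b := (le_max_right _ _).trans (le_max_left _ _)
  have hba : a ≤ b := (le_max_left _ _).trans (le_max_right _ _)
  have hb0 : 0 ≤ b := (le_max_right _ _).trans (le_max_right _ _)
  have hgpos : ∀ t, b ≤ t → 0 ≤ g t := fun t ht => ht₀.trans (hg (hbt₀.trans ht))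
  -- beyond `t₁` the squared slope `c W` is at least `1`
  set t₁ := b + 1 / (c * f b) with ht₁
  have hfb := hf0 b
  have hbt₁ : b ≤ t₁ := by
    have : 0 < 1 / (c * f b) := by positivity
    linarith
  have hW1 : ∀ t, t₁ ≤ t → 1 ≤ c * W t := by
    intro t ht
    have h1 := mul_le_dampedPrimitive hq0 hf_cont hf0 hf hg_cont hg hba (hbt₁.trans ht)
      (hgpos b le_rfl)
    have h2 : 1 / (c * f b) ≤ t - b := by linarith
    rw [div_le_iff₀ (by positivity)] at h2
    nlinarith
  set G : ℝ → ℝ := fun t => max (g t) 0 with hG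
  have hG0 : ∀ t, 0 ≤ G t := fun t => le_max_right _ _
  have hGm : Monotone G := fun s t hst => max_le_max (hg hst) le_rfl
  have hGc : Continuous G := hg_cont.max continuous_const
  set g₁ : ℝ → ℝ := fun t => G t * max 0 (min 1 (t - t₁)) with hg₁
  have hg₁c : Continuous g₁ := by fun_prop
  have hg₁0 : ∀ t, 0 ≤ g₁ t := fun t => mul_nonneg (hG0 t) (le_max_left _ _)
  have hg₁G : ∀ t, g₁ t ≤ G t := fun t =>
    mul_le_of_le_one_right (hG0 t) (max_le zero_le_one (min_le_left _ _))
  have hg₁z : ∀ t, t ≤ t₁ → g₁ t = 0 := fun t ht => by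
    have : max 0 (min 1 (t - t₁)) = 0 := max_eq_left (min_le_of_right_le (by linarith))
    rw [hg₁]; beta_reduce; rw [this, mul_zero]
  have hg₁e : ∀ t, t₁ + 1 ≤ t → g₁ t = G t := fun t ht => by
    have : max 0 (min 1 (t - t₁)) = 1 := by
      rw [min_eq_left (by linarith)]; exact max_eq_right zero_le_one
    rw [hg₁]; beta_reduce; rw [this, mul_one]
  set H : ℝ → ℝ := fun t => ∫ s in t₁..t, g₁ s with hH
  have hHd : ∀ t, HasDerivAt H (g₁ t) t := hasDerivAt_primitive hg₁c t₁
  have hHc : Continuous H := continuous_iff_continuousAt.2 fun t => (hHd t).continuousAt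
  have hHz : ∀ t, t ≤ t₁ → H t = 0 := by
    intro t ht
    rw [hH]; beta_reduce
    rw [intervalIntegral.integral_congr (g := fun _ => (0 : ℝ)) fun s hs => ?_]
    · simp
    · rw [uIcc_of_ge ht] at hs
      exact hg₁z s hs.2
  have hH0 : ∀ t, 0 ≤ H t := by
    intro t
    rcases le_total t t₁ with h | h
    · rw [hHz t h]
    · exact intervalIntegral.integral_nonneg h fun s _ => hg₁0 s
  set κ : ℝ := 2 / (n * p) with hκ
  have hκ0 : 0 < κ := by positivity
  set E : ℝ → ℝ := fun t => c * W t + (κ * H t) ^ p with hE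
  set E' : ℝ → ℝ := fun t => c * (f t - 2 * damping f g q t * W t) +
    κ * g₁ t * p * (κ * H t) ^ (p - 1) with hE'
  have hW' := isEnergy_const_mul_dampedPrimitive hk hf_cont hf0 hkf hc a
  have hHp0 : ∀ t, 0 ≤ (κ * H t) ^ (p - 1) := fun t =>
    Real.rpow_nonneg (mul_nonneg hκ0.le (hH0 t)) _
  have hat₁ : a ≤ t₁ := hba.trans hbt₁
  have hEn : IsEnergy E E' a := by
    refine ⟨fun t => ?_, ?_, ?_, ?_, fun t ht => ?_⟩
    · exact (hW'.hasDerivAt t).add (((hHd t).const_mul κ).rpow_const (Or.inr hp1.le))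
    · have h1 : Continuous fun t => (κ * H t) ^ (p - 1) :=
        (continuous_const.mul hHc).rpow_const fun _ => Or.inr (by linarith)
      have h2 := hW'.continuous_deriv
      fun_prop
    · have h1 := hW'.apply_base
      simp only [hE, hHz a hat₁, mul_zero, Real.zero_rpow hp0.ne', add_zero]
      exact h1
    · have h1 := hW'.deriv_base_pos
      simp only [hE', hg₁z a hat₁, mul_zero, zero_mul, add_zero]
      exact h1
    · exact add_nonneg (hW'.deriv_nonneg t ht)
        (mul_nonneg (mul_nonneg (mul_nonneg hκ0.le (hg₁0 t)) hp0.le) (hHp0 t))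
  have hWn : ∀ t, a ≤ t → 0 ≤ c * W t := fun t ht =>
    mul_nonneg hc.le (dampedPrimitive_nonneg hf0 ht)
  have hHpn : ∀ t, 0 ≤ (κ * H t) ^ p := fun t => Real.rpow_nonneg (mul_nonneg hκ0.le (hH0 t)) _
  have hineq : ∀ t, a ≤ t →
      E' t ≤ 2 * (f t / n + (max (g t) 0 / n - max (-g t) 0) * √(E t) ^ q) := by
    intro t ht
    have h1 := hsup a t ht
    rw [← hW] at h1
    rcases le_total t t₁ with h | h
    · simp only [hE, hE', hHz t h, hg₁z t h, mul_zero, zero_mul, add_zero,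
        Real.zero_rpow hp0.ne']
      have h2 : 0 ≤ max (g t) 0 / n * √(c * W t) ^ q :=
        mul_nonneg (div_nonneg (le_max_right _ _) hn0.le) (by positivity)
      linarith
    · have hgt := hgpos t (hbt₁.trans h)
      rw [max_eq_right (neg_nonpos.2 hgt), zero_mul, sub_zero] at h1
      rw [max_eq_right (neg_nonpos.2 hgt), sub_zero]
      have hE1 : 1 ≤ √(E t) := by
        rw [Real.one_le_sqrt]
        have := hW1 t h
        have := hHpn t
        simp only [hE]
        linarith
      have h2 : (κ * H t) ^ (p - 1) ≤ √(E t) ^ q := by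
        refine le_trans ?_ (Real.rpow_le_rpow_of_exponent_le hE1 hrq)
        have e1 : √((κ * H t) ^ p) ≤ √(E t) :=
          Real.sqrt_le_sqrt (by have := hWn t ht; simp only [hE]; linarith)
        refine le_trans (le_of_eq ?_) (Real.rpow_le_rpow (Real.sqrt_nonneg _) e1 hr0.le)
        rw [Real.sqrt_eq_rpow, ← Real.rpow_mul (mul_nonneg hκ0.le (hH0 t)),
          ← Real.rpow_mul (mul_nonneg hκ0.le (hH0 t)), ← hpr]
        congr 1; ring
      have h3 : κ * g₁ t * p * (κ * H t) ^ (p - 1) ≤ 2 * (max (g t) 0 / n * √(E t) ^ q) := by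
        have e1 : κ * g₁ t * p = 2 / n * g₁ t := by rw [hκ]; field_simp
        have e2 : 2 * (max (g t) 0 / n * √(E t) ^ q) = 2 / n * (G t * √(E t) ^ q) := by
          simp only [hG]; ring
        rw [e1, e2, mul_assoc]
        exact mul_le_mul_of_nonneg_left
          (mul_le_mul (hg₁G t) h2 (hHp0 t) (hG0 t)) (by positivity)
      simp only [hE'] at h3 ⊢
      linarith
  obtain ⟨B, hB⟩ := hEn.exists_travelTime_le_of_lintegral_ne_top (b := 2 * (t₁ + 1))
    (by linarith) (by
      refine lintegral_Ioi_ne_top_of_le (c := 1 / 2) (C := (√c)⁻¹ + (κ ^ (1 / (2 - r)))⁻¹)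
        (by norm_num) (by positivity) (fun t ht => ?_)
        (ne_top_of_le_ne_top hfin (lintegral_mono_set (Ioi_subset_Ioi (by linarith))))
      set τ : ℝ := 1 / 2 * t with hτ
      have hτ1 : t₁ + 1 < τ := by linarith
      have hτ0 : 0 < τ := by linarith
      have htτ : t - τ = τ := by rw [hτ]; ring
      have hτt : τ ≤ t := by linarith
      have hfτ := hf0 τ
      have hc1 : τ * f τ ≤ W t := by
        have := mul_le_dampedPrimitive hq0 hf_cont hf0 hf hg_cont hg (show a ≤ τ by linarith) hτt
          (hgpos τ (by linarith))
        rwa [htτ] at this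
      have hc2 : τ * G τ ≤ H t := by
        have h1 : H t = H τ + ∫ s in τ..t, g₁ s :=
          (intervalIntegral.integral_add_adjacent_intervals (hg₁c.intervalIntegrable _ _)
            (hg₁c.intervalIntegrable _ _)).symm
        have h2 : ∫ s in τ..t, g₁ s = ∫ s in τ..t, G s :=
          intervalIntegral.integral_congr fun s hs => by
            rw [uIcc_of_le hτt] at hs
            exact hg₁e s (by linarith [hs.1])
        have h3 := mul_le_integral_of_monotone hGc hGm hτt
        rw [htτ] at h3
        have := hH0 τ
        linarith
      have hEpos : 0 < √(E t) := Real.sqrt_pos.2 (hEn.pos (by linarith))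
      have d1 : √c * (τ * f τ) ^ (1 / 2 : ℝ) ≤ √(E t) := by
        rw [← Real.sqrt_eq_rpow, ← Real.sqrt_mul hc.le]
        refine Real.sqrt_le_sqrt ?_
        have := hHpn t
        simp only [hE]
        nlinarith
      have hGτ : 0 ≤ τ * G τ := mul_nonneg hτ0.le (hG0 τ)
      have d2 : κ ^ (1 / (2 - r)) * (τ * G τ) ^ (1 / (2 - r)) ≤ √(E t) := by
        rw [← Real.mul_rpow hκ0.le hGτ]
        have e1 : (κ * (τ * G τ)) ^ (1 / (2 - r)) = √((κ * (τ * G τ)) ^ p) := by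
          rw [Real.sqrt_eq_rpow, ← Real.rpow_mul (by positivity), hp]
          congr 1; field_simp
        rw [e1]
        refine Real.sqrt_le_sqrt ?_
        have h1 : (κ * (τ * G τ)) ^ p ≤ (κ * H t) ^ p :=
          Real.rpow_le_rpow (by positivity) (by gcongr) hp0.le
        have h2 := hWn t (by linarith)
        simp only [hE]
        linarith
      have hsc : 0 < √c := Real.sqrt_pos.2 hc
      have hκr : 0 < κ ^ (1 / (2 - r)) := by positivity
      have e1 : (τ * f τ) ^ (1 / 2 : ℝ) ≤ (√c)⁻¹ * √(E t) := by
        rw [inv_mul_eq_div, le_div_iff₀ hsc]; linarith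
      have e2 : (τ * G τ) ^ (1 / (2 - r)) ≤ (κ ^ (1 / (2 - r)))⁻¹ * √(E t) := by
        rw [inv_mul_eq_div, le_div_iff₀ hκr]; linarith
      have e3 : 0 < (τ * f τ) ^ (1 / 2 : ℝ) + (τ * G τ) ^ (1 / (2 - r)) := by positivity
      rw [mul_one_div, inv_eq_one_div, div_le_div_iff₀ hEpos e3]
      linarith)
  have := hEn.apply_zero_le_of_subsolution hn hq0 hq2 hf' hg hB hineq hu
  linarith

end PositiveLimit

/-! ### The three cases -/

theorem mainTheorem1 (n : ℕ) (hn : 1 ≤ n) (q : ℝ) (hq0 : 0 < q) (hq2 : q ≤ 2)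
    (f g : ℝ → ℝ) (hf_cont : Continuous f) (hf_pos : ∀ t, 0 < f t) (hf_mono : StrictMono f)
    (hg_cont : Continuous g) (hg_mono : Monotone g)
    (L : EReal) (hL : Tendsto (fun t : ℝ => (g t : EReal)) atTop (𝓝 L)) :
    (0 < L →
      ((∃ u : EuclideanSpace ℝ (Fin n) → ℝ, IsEntireViscositySubsolution f g q u) ↔
        KellerOssermanPos f g q)) ∧
    (L = 0 →
      ((∃ u : EuclideanSpace ℝ (Fin n) → ℝ, IsEntireViscositySubsolution f g q u) ↔
        KellerOssermanZero f g q)) ∧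
    (L < 0 →
      ((∃ u : EuclideanSpace ℝ (Fin n) → ℝ, IsEntireViscositySubsolution f g q u) ↔
        KellerOssermanNeg f q)) := by
  have hgL : ∀ t, (g t : EReal) ≤ L := fun t =>
    Monotone.ge_of_tendsto (fun s t hst => EReal.coe_le_coe_iff.2 (hg_mono hst)) hL t
  refine ⟨fun hL0 => ⟨?_, fun hKO => exists_subsolution_of_kellerOssermanPos hn hq0 hf_cont hf_pos
    hf_mono.monotone hg_cont hg_mono hKO⟩, fun hL0 => ?_, fun hL0 => ?_⟩
  · rintro ⟨u, hu⟩
    obtain ⟨t₀, ht₀⟩ := (hL.eventually (lt_mem_nhds hL0)).exists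
    have hg₀ : 0 < g t₀ := by exact_mod_cast ht₀
    by_contra hKO
    rw [KellerOssermanPos, not_and_or, not_le] at hKO
    by_cases hq1 : q ≤ 1
    · exact not_exists_subsolution_of_lintegral_ne_top hn hq0 hq2 hf_cont hf_pos hf_mono hg_cont
        hg_mono hq0 le_rfl (by linarith) hg₀.le (hKO.resolve_left (not_lt.2 hq1)) hu
    · rw [not_le] at hq1
      set r := min q (3 / 2) with hr
      have hr1 : 1 < r := lt_min hq1 (by norm_num)
      have hr2 : r < 2 := (min_le_right _ _).trans_lt (by norm_num)
      have h2r : 0 < 2 - r := by linarith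
      have hT0 : 0 < max t₀ 1 := lt_max_of_lt_right one_pos
      -- the gradient term alone makes the integral converge, like that of `t^{-1/(2-r)}`
      refine not_exists_subsolution_of_lintegral_ne_top hn hq0 hq2 hf_cont hf_pos hf_mono hg_cont
        hg_mono (T := max t₀ 1) (by linarith) (min_le_left q (3 / 2)) hr2 hg₀.le ?_ hu
      have hexp : 1 < 1 / (2 - r) := by rw [lt_div_iff₀ h2r]; linarith
      refine lintegral_Ioi_ne_top_of_le (c := 1) (G := fun t => t ^ (-(1 / (2 - r))))
        (C := (g t₀ ^ (1 / (2 - r)))⁻¹) one_pos (by positivity) (fun t ht => ?_) ?_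
      · have ht0 : 0 < t := hT0.trans ht
        have hgt : g t₀ ≤ max (g t) 0 :=
          le_max_of_le_left (hg_mono ((le_max_left _ _).trans ht.le))
        rw [one_mul, Real.rpow_neg ht0.le, ← mul_inv, ← Real.mul_rpow hg₀.le ht0.le, ← one_div]
        refine one_div_le_one_div_of_le (by positivity) ?_
        have h1 : (g t₀ * t) ^ (1 / (2 - r)) ≤ (t * max (g t) 0) ^ (1 / (2 - r)) := by
          refine Real.rpow_le_rpow (by positivity) ?_ (by positivity)
          rw [mul_comm]
          gcongr
        have h2 : 0 ≤ (t * f t) ^ (1 / 2 : ℝ) :=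
          Real.rpow_nonneg (mul_nonneg ht0.le (hf_pos t).le) _
        linarith
      · rw [one_mul]
        exact (integrableOn_Ioi_rpow_of_lt (by linarith) hT0).lintegral_lt_top.ne
  · refine exists_subsolution_iff_kellerOssermanZero hq0 hq2 hf_cont hf_pos hg_cont hg_mono hn
      hf_mono fun t => ?_
    have := hgL t
    rw [hL0] at this
    exact_mod_cast this
  · obtain ⟨m, hm1, hm2⟩ := EReal.lt_iff_exists_real_btwn.1 hL0
    have hm0 : 0 < -m := by
      have : m < 0 := by exact_mod_cast hm2
      linarith
    have hgm : ∀ t, g t ≤ -(-m) := fun t => by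
      rw [neg_neg]
      exact EReal.coe_le_coe_iff.1 ((hgL t).trans hm1.le)
    rw [← kellerOssermanZero_iff_kellerOssermanNeg hq0 hq2 hf_cont hf_pos hf_mono.monotone hg_cont
      hg_mono hm0 hgm]
    exact exists_subsolution_iff_kellerOssermanZero hq0 hq2 hf_cont hf_pos hg_cont hg_mono hn
      hf_mono fun t => by have := hgm t; linarith
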